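/- Let $K$ be a field of characteristic $2$, let $A$ be an associative commutative $K$-algebra with unit, and let $D$ be a nonzero $K$-linear derivation of $A$. Let $\mathsf{s}$ be the $3$-dimensional Lie algebra over $K$ with basis $e,h,f$ and brackets $[e,h]=e$, $[f,h]=f$, $[e,f]=h$, and let $L=\mathsf{s}\otimes A+KD$ be the semidirect sum of the current Lie algebra $\mathsf{s}\otimes A$ (bracket $[x\otimes a,y\otimes b]=[x,y]\otimes ab$) and the one-dimensional Lie algebra $KD$, where $[x\otimes a,D]=x\otimes D(a)$. Grade $L$ by $L_{-1}=e\otimes A$, $L_0=h\otimes A+KD$, $L_1=f\otimes A$, and $L_i=0$ for all other $i$. For $\lambda\in\mathbb Z$ let $H^2_\lambda(L,L)$ be the space of classes in the Chevalley--Eilenberg cohomology $H^2(L,L)$ of $2$-cocycles $\varphi$ with $\varphi(L_i,L_j)\subseteq L_{i+j+\lambda}$ for all $i,j$, and let $H^2_+(L,L)=\bigoplus_{\lambda>0}H^2_\lambda(L,L)$. Let $A^D=\{a\in A: D(a)=0\}$, and let $\Xi_{D,0}$ be the space of linear maps $\xi:A\to K$ which vanish on $D(A)$ and on the linear span of all squares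 $a^2$, $a\in A$, and satisfy, for all $a,b,c\in A$, the conditions $\xi(a)D(b)+\xi(b)D(a)=0$ and $$\big(\xi(a)b+\xi(b)a+\xi(ab)1\big)D(c)+\big(\xi(c)a+\xi(a)c+\xi(ca)1\big)D(b)+\big(\xi(b)c+\xi(c)b+\xi(bc)1\big)D(a)=0.$$ Then there is an isomorphism of vector spaces $$H^2_+(L,L)\simeq A^D\oplus\frac{A}{D(A)}\oplus\Xi_{D,0},$$ under which $v\in A^D$, the coset of $w\in A$ in $A/D(A)$, and $\xi\in\Xi_{D,0}$ correspond, respectively, to the classes of the following $2$-cocycles, all of weight $\lambda=2$ (the values not listed, up to the order of the arguments, are zero): (i) $(e\otimes a)\wedge(h\otimes b)\mapsto f\otimes abv$; (ii) $(e\otimes a)\wedge D\mapsto f\otimes aw$; (iii) $(e\otimes a)\wedge(e\otimes b)\mapsto\xi(ab)D$ and $(e\otimes a)\wedge(h\otimes b)\mapsto f\otimes\xi(b)D(a)$. -/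

import Mathlib

open scoped TensorProduct DirectSum
open LieModule.Cohomology

noncomputable section

namespace CurrentLie

/-! ### The 3-dimensional simple Lie algebra in characteristic 2 -/

/-- The Lie algebra with basis `e, h, f` (in this order) and multiplication table
`[e,h] = e`, `[f,h] = f`, `[e,f] = h`. -/
def Ess (K : Type*) : Type _ := Fin 3 → K

namespace Ess

set_option linter.unusedSectionVars false

variable {K : Type*} [Field K]

instance : AddCommGroup (Ess K) := inferInstanceAs (AddCommGroup (Fin 3 → K))
instance : Module K (Ess K) := inferInstanceAs (Module K (Fin 3 → K))

/-- The `i`-th coordinate with respect to the basis `e, h, f`. -/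
def coord (i : Fin 3) : Ess K →ₗ[K] K := LinearMap.proj (R := K) (φ := fun _ : Fin 3 => K) i

/-- The element `a e + b h + c f`. -/
def mk (a b c : K) : Ess K := (![a, b, c] : Fin 3 → K)

@[simp] theorem mk_zero (a b c : K) : mk a b c 0 = a := rfl
@[simp] theorem mk_one (a b c : K) : mk a b c 1 = b := rfl
@[simp] theorem mk_two (a b c : K) : mk a b c 2 = c := rfl
@[simp] theorem zero_apply (i : Fin 3) : (0 : Ess K) i = 0 := rfl
@[simp] theorem add_apply (x y : Ess K) (i : Fin 3) : (x + y) i = x i + y i := rfl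
@[simp] theorem smul_apply (c : K) (x : Ess K) (i : Fin 3) : (c • x) i = c * x i := rfl

theorem ext {x y : Ess K} (h0 : x 0 = y 0) (h1 : x 1 = y 1) (h2 : x 2 = y 2) : x = y := by
  funext i
  fin_cases i
  · exact h0
  · exact h1
  · exact h2

variable (K) in
/-- The basis element `e`, of degree `-1`. -/
def e : Ess K := mk 1 0 0

variable (K) in
/-- The basis element `h`, of degree `0`. -/
def h : Ess K := mk 0 1 0

variable (K) in
/-- The basis element `f`, of degree `1`. -/
def f : Ess K := mk 0 0 1

instance : Bracket (Ess K) (Ess K) where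
  bracket x y := mk (x 0 * y 1 - x 1 * y 0) (x 0 * y 2 - x 2 * y 0) (x 2 * y 1 - x 1 * y 2)

theorem lie_def (x y : Ess K) :
    ⁅x, y⁆ = mk (x 0 * y 1 - x 1 * y 0) (x 0 * y 2 - x 2 * y 0) (x 2 * y 1 - x 1 * y 2) := rfl

variable [CharP K 2]

instance : LieRing (Ess K) where
  add_lie x y z := by apply ext <;> simp [lie_def] <;> ring
  lie_add x y z := by apply ext <;> simp [lie_def] <;> ring
  lie_self x := by apply ext <;> simp [lie_def] <;> ring
  leibniz_lie x y z := by
    have h2 : (2 : K) = 0 := CharTwo.two_eq_zero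
    apply ext <;> simp [lie_def] <;> grind

instance : LieAlgebra K (Ess K) where
  lie_smul c x y := by apply ext <;> simp [lie_def] <;> ring

theorem lie_e_h : ⁅e K, h K⁆ = e K := by apply ext <;> simp [lie_def, e, h]

theorem lie_f_h : ⁅f K, h K⁆ = f K := by apply ext <;> simp [lie_def, f, h]

theorem lie_e_f : ⁅e K, f K⁆ = h K := by apply ext <;> simp [lie_def, e, f, h]

end Ess

/-! ### The current Lie algebra extended by a derivation -/

section Extended

variable {K A : Type*} [Field K] [CommRing A] [Algebra K A]

/-- The one-dimensional (abelian) Lie algebra `K D`; the scalar `c` stands for `c D`. -/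
def Line (_D : Derivation K A A) : Type _ := K

variable (D : Derivation K A A)

namespace Line

instance : AddCommGroup (Line D) := inferInstanceAs (AddCommGroup K)
instance : Module K (Line D) := inferInstanceAs (Module K K)

instance : Bracket (Line D) (Line D) where
  bracket _ _ := 0

theorem lie_def (x y : Line D) : ⁅x, y⁆ = 0 := rfl

instance : LieRing (Line D) where
  add_lie x y z := by simp [lie_def]
  lie_add x y z := by simp [lie_def]
  lie_self x := by simp [lie_def]
  leibniz_lie x y z := by simp [lie_def]

instance : LieAlgebra K (Line D) where
  lie_smul c x y := by simp [lie_def]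

/-- The coefficient `c` of `c D`, as a linear map. -/
def coeff : Line D →ₗ[K] K := (LinearMap.id : K →ₗ[K] K)

/-- The linear map `c ↦ c D`. -/
def ofScalar : K →ₗ[K] Line D := (LinearMap.id : K →ₗ[K] K)

end Line

variable [CharP K 2]

/-- The derivation `x ⊗ a ↦ x ⊗ D(a)` of the current Lie algebra (realized as `A ⊗ Ess K`,
with `x ⊗ a` written as `a ⊗ₜ x`). -/
def currentDer : LieDerivation K (A ⊗[K] Ess K) (A ⊗[K] Ess K) where
  toLinearMap := LinearMap.rTensor (Ess K) D.toLinearMap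
  leibniz' X Y := by
    induction X using TensorProduct.induction_on with
    | zero => simp
    | add X X' hX hX' =>
      rw [add_lie, map_add, hX, hX', map_add, lie_add, add_lie]; abel
    | tmul a x =>
      induction Y using TensorProduct.induction_on with
      | zero => simp
      | add Y Y' hY hY' =>
        rw [lie_add, map_add, hY, hY', map_add, lie_add, add_lie]; abel
      | tmul b y =>
        simp only [LieAlgebra.ExtendScalars.bracket_tmul, LinearMap.rTensor_tmul,
          Derivation.coeFn_coe, Derivation.leibniz, smul_eq_mul, TensorProduct.add_tmul]
        rw [← lie_skew x y, TensorProduct.tmul_neg, TensorProduct.tmul_neg, sub_eq_add_neg]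

/-- The action of `K D` on the current Lie algebra by derivations. -/
def action : Line D →ₗ⁅K⁆ LieDerivation K (A ⊗[K] Ess K) (A ⊗[K] Ess K) where
  toLinearMap := (Line.coeff D).smulRight (currentDer D)
  map_lie' {x y} := by
    simp [Line.lie_def, smul_lie, lie_smul]

/-- The semidirect sum of the current Lie algebra and `K D`. -/
abbrev Ext : Type _ := LieAlgebra.SemiDirectSum (A ⊗[K] Ess K) (Line D) (action D)

variable {D} in
/-- The linear map `a ↦ x ⊗ a` into the extended algebra. -/
def cur (x : Ess K) : A →ₗ[K] Ext D :=
  (LieAlgebra.SemiDirectSum.inl (action D)).toLinearMap ∘ₗ (TensorProduct.mk K A (Ess K)).flip x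

/-- The linear map `c ↦ c D` into the extended algebra. -/
def line : K →ₗ[K] Ext D :=
  (LieAlgebra.SemiDirectSum.inr (action D)).toLinearMap ∘ₗ Line.ofScalar D

/-- The `A`-valued coordinates of an element with respect to `e, h, f`: an element of the
extended algebra is `e ⊗ crd 0 + h ⊗ crd 1 + f ⊗ crd 2` modulo `K D`. -/
def crd (i : Fin 3) : Ext D →ₗ[K] A :=
  (TensorProduct.rid K A).toLinearMap ∘ₗ LinearMap.lTensor A (Ess.coord i) ∘ₗ
    LieAlgebra.SemiDirectSum.projl (action D)

/-- The coefficient of `D` of an element of the extended algebra. -/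
def dcoef : Ext D →ₗ[K] K :=
  Line.coeff D ∘ₗ (LieAlgebra.SemiDirectSum.projr (action D)).toLinearMap

/-- The standard grading: `e ⊗ A` in degree `-1`, `h ⊗ A + K D` in degree `0`,
`f ⊗ A` in degree `1`. -/
def grading (n : ℤ) : Submodule K (Ext D) :=
  if n = -1 then LinearMap.range (cur (Ess.e K))
  else if n = 0 then LinearMap.range (cur (Ess.h K)) ⊔ LinearMap.range (line D)
  else if n = 1 then LinearMap.range (cur (Ess.f K))
  else ⊥

end Extended

/-! ### Second cohomology, its weight components and its positive part -/

section Cohomology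

variable (K L M : Type*) [CommRing K] [LieRing L] [LieAlgebra K L]
  [AddCommGroup M] [Module K M] [LieRingModule L M] [LieModule K L M]

/-- The 2-coboundaries, as a space of bilinear maps. -/
def B2 : Submodule K (L →ₗ[K] L →ₗ[K] M) :=
  (LinearMap.range (d₁₂ K L M)).map (twoCochain K L M).subtype

/-- The 2-cocycles (alternating bilinear maps annihilated by the coboundary operator), as a space
of bilinear maps. -/
def Z2 : Submodule K (L →ₗ[K] L →ₗ[K] M) :=
  (twoCocycle K L M).map (twoCochain K L M).subtype

/-- The second Chevalley-Eilenberg cohomology: cocycles modulo coboundaries, realized as the image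
of the space of cocycles in the space of bilinear maps modulo coboundaries. -/
def H2 : Submodule K ((L →ₗ[K] L →ₗ[K] M) ⧸ B2 K L M) := (Z2 K L M).map (B2 K L M).mkQ

theorem B2_le_Z2 : B2 K L M ≤ Z2 K L M := by
  refine Submodule.map_mono ?_
  rintro _ ⟨g, rfl⟩
  exact LinearMap.congr_fun (d₂₃_comp_d₁₂ K L M) g

variable {K L M}

/-- The cocycles of weight `l`, i.e. those mapping `L i × L j` to `M (i + j + l)`. -/
def Z2Wt (𝒜 : ℤ → Submodule K L) (ℳ : ℤ → Submodule K M) (l : ℤ) :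
    Submodule K (L →ₗ[K] L →ₗ[K] M) where
  carrier := {φ | φ ∈ Z2 K L M ∧ ∀ i j : ℤ, ∀ x ∈ 𝒜 i, ∀ y ∈ 𝒜 j, φ x y ∈ ℳ (i + j + l)}
  add_mem' hφ hψ := ⟨(Z2 K L M).add_mem hφ.1 hψ.1, fun i j x hx y hy =>
    (ℳ (i + j + l)).add_mem (hφ.2 i j x hx y hy) (hψ.2 i j x hx y hy)⟩
  zero_mem' := ⟨(Z2 K L M).zero_mem, fun i j _ _ _ _ => (ℳ (i + j + l)).zero_mem⟩
  smul_mem' c _ hφ := ⟨(Z2 K L M).smul_mem c hφ.1, fun i j x hx y hy =>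
    (ℳ (i + j + l)).smul_mem c (hφ.2 i j x hx y hy)⟩

/-- The component of weight `l` of the second cohomology: the space of classes of cocycles of
weight `l`. -/
def H2Wt (𝒜 : ℤ → Submodule K L) (ℳ : ℤ → Submodule K M) (l : ℤ) :
    Submodule K ((L →ₗ[K] L →ₗ[K] M) ⧸ B2 K L M) :=
  (Z2Wt 𝒜 ℳ l).map (B2 K L M).mkQ

theorem H2Wt_le (𝒜 : ℤ → Submodule K L) (ℳ : ℤ → Submodule K M) (l : ℤ) :
    H2Wt 𝒜 ℳ l ≤ H2 K L M :=
  Submodule.map_mono fun _ hφ => hφ.1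

/-- The positive second cohomology: the direct sum of the components of positive weight. -/
abbrev H2Pos (𝒜 : ℤ → Submodule K L) (ℳ : ℤ → Submodule K M) : Type _ :=
  ⨁ l : {l : ℤ // 0 < l}, H2Wt 𝒜 ℳ l.1

/-- The cohomology class of a cocycle of positive weight `l`. -/
def posClass {𝒜 : ℤ → Submodule K L} {ℳ : ℤ → Submodule K M} (l : ℤ) (hl : 0 < l)
    (φ : L →ₗ[K] L →ₗ[K] M) (hφ : φ ∈ Z2Wt 𝒜 ℳ l) : H2Pos 𝒜 ℳ :=
  DirectSum.lof K {l : ℤ // 0 < l} (fun l => H2Wt 𝒜 ℳ l.1) ⟨l, hl⟩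
    ⟨(B2 K L M).mkQ φ, Submodule.mem_map_of_mem hφ⟩

end Cohomology

/-! ### The ingredients of the answer -/

section Answer

variable {K A : Type*} [Field K] [CommRing A] [Algebra K A]

variable (K A) in
/-- The linear span of the squares of all elements of `A`. -/
def squares : Submodule K A := Submodule.span K (Set.range fun a : A => a ^ 2)

/-- The kernel `{a ∈ A | D(a) = 0}` of `D`. -/
def invariants (D : Derivation K A A) : Submodule K A := LinearMap.ker D.toLinearMap

/-- The image `D(A)` of `D`. -/
def image (D : Derivation K A A) : Submodule K A := LinearMap.range D.toLinearMap

/-- The space of linear maps `ξ : A → K` vanishing on the squares, on `D(A)` and on `U`, such that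
`ξ(a)D(b) + ξ(b)D(a) ∈ U` and
`(ξ(a)b + ξ(b)a + ξ(ab)1)D(c) + (ξ(c)a + ξ(a)c + ξ(ca)1)D(b) + (ξ(b)c + ξ(c)b + ξ(bc)1)D(a) = 0`
for all `a, b, c`. -/
def Xi (D : Derivation K A A) (U : Submodule K A) : Submodule K (A →ₗ[K] K) where
  carrier := {ξ | (∀ a ∈ squares K A, ξ a = 0) ∧ (∀ a ∈ image D, ξ a = 0) ∧ (∀ a ∈ U, ξ a = 0) ∧
    (∀ a b : A, ξ a • D b + ξ b • D a ∈ U) ∧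
    ∀ a b c : A,
      (ξ a • b + ξ b • a + ξ (a * b) • (1 : A)) * D c +
      (ξ c • a + ξ a • c + ξ (c * a) • (1 : A)) * D b +
      (ξ b • c + ξ c • b + ξ (b * c) • (1 : A)) * D a = 0}
  add_mem' {ξ η} := by
    rintro ⟨h1, h2, h3, h4, h5⟩ ⟨k1, k2, k3, k4, k5⟩
    refine ⟨fun a ha => by simp [h1 a ha, k1 a ha], fun a ha => by simp [h2 a ha, k2 a ha],
      fun a ha => by simp [h3 a ha, k3 a ha], fun a b => ?_, fun a b c => ?_⟩
    · have := U.add_mem (h4 a b) (k4 a b)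
      simp only [LinearMap.add_apply, add_smul]
      convert this using 1
      abel
    · have := congrArg₂ (· + ·) (h5 a b c) (k5 a b c)
      simp only [LinearMap.add_apply, add_smul, add_zero] at this ⊢
      rw [← this]
      ring
  zero_mem' := by simp
  smul_mem' t ξ := by
    rintro ⟨h1, h2, h3, h4, h5⟩
    refine ⟨fun a ha => by simp [h1 a ha], fun a ha => by simp [h2 a ha],
      fun a ha => by simp [h3 a ha], fun a b => ?_, fun a b c => ?_⟩
    · have := U.smul_mem t (h4 a b)
      simpa only [LinearMap.smul_apply, smul_eq_mul, smul_add, mul_smul] using this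
    · have := congrArg (t • ·) (h5 a b c)
      simpa only [LinearMap.smul_apply, smul_eq_mul, smul_add, mul_smul, smul_zero,
        ← smul_mul_assoc] using this

end Answer

/-! ### The basic cochains -/

section Cochains

variable {K A : Type*} [Field K] [CommRing A] [Algebra K A] [CharP K 2]

/-- In characteristic 2 the element `x + x` vanishes. -/
theorem add_self_eq_zero {V : Type*} [AddCommGroup V] [Module K V] (x : V) : x + x = 0 := by
  rw [← two_smul K x, (CharTwo.two_eq_zero : (2 : K) = 0), zero_smul]

variable (D : Derivation K A A)

/-- The cochain `(e ⊗ a) ∧ (h ⊗ b) ↦ f ⊗ abv`, zero on all other pairs. -/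
def cochainI (v : A) : twoCochain K (Ext D) (Ext D) :=
  ⟨LinearMap.mk₂ K
    (fun X Y => cur (Ess.f K) (crd D 0 X * crd D 1 Y * v + crd D 0 Y * crd D 1 X * v))
    (fun X X' Y => by simp only [← map_add]; congr 1; simp only [map_add]; ring)
    (fun t X Y => by
      rw [← map_smul]; congr 1
      simp only [map_smul, smul_mul_assoc, mul_smul_comm, smul_add])
    (fun X Y Y' => by simp only [← map_add]; congr 1; simp only [map_add]; ring)
    (fun t X Y => by
      rw [← map_smul]; congr 1
      simp only [map_smul, smul_mul_assoc, mul_smul_comm, smul_add]),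
  fun X => by simp only [LinearMap.mk₂_apply, add_self_eq_zero (K := K), map_zero]⟩

/-- The cochain `(e ⊗ a) ∧ D ↦ f ⊗ aw`, zero on all other pairs. -/
def cochainII (w : A) : twoCochain K (Ext D) (Ext D) :=
  ⟨LinearMap.mk₂ K
    (fun X Y => cur (Ess.f K) (dcoef D Y • (crd D 0 X * w) + dcoef D X • (crd D 0 Y * w)))
    (fun X X' Y => by
      simp only [← map_add]; congr 1; simp only [map_add, add_mul, add_smul, smul_add]; abel)
    (fun t X Y => by
      rw [← map_smul]; congr 1
      simp only [map_smul, smul_mul_assoc, smul_add, smul_eq_mul, mul_smul, smul_comm t])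
    (fun X Y Y' => by
      simp only [← map_add]; congr 1; simp only [map_add, add_mul, add_smul, smul_add]; abel)
    (fun t X Y => by
      rw [← map_smul]; congr 1
      simp only [map_smul, smul_mul_assoc, smul_add, smul_eq_mul, mul_smul, smul_comm t]),
  fun X => by simp only [LinearMap.mk₂_apply, add_self_eq_zero (K := K), map_zero]⟩

/-- The cochain `(e ⊗ a) ∧ (e ⊗ b) ↦ ξ(ab) D`, `(e ⊗ a) ∧ (h ⊗ b) ↦ f ⊗ ξ(b) D(a)`, zero on all
other pairs. -/
def cochainIII (ξ : Xi D (⊥ : Submodule K A)) : twoCochain K (Ext D) (Ext D) :=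
  ⟨LinearMap.mk₂ K
    (fun X Y => line D (ξ.1 (crd D 0 X * crd D 0 Y)) +
      cur (Ess.f K) (ξ.1 (crd D 1 Y) • D (crd D 0 X) + ξ.1 (crd D 1 X) • D (crd D 0 Y)))
    (fun X X' Y => by simp only [map_add, add_mul, add_smul, smul_add]; abel)
    (fun t X Y => by
      simp only [map_smul, smul_mul_assoc, smul_add, map_add, Derivation.map_smul, smul_eq_mul,
        mul_smul, smul_comm t]
      rfl)
    (fun X Y Y' => by simp only [map_add, mul_add, add_smul, smul_add]; abel)
    (fun t X Y => by
      simp only [map_smul, mul_smul_comm, smul_add, map_add, Derivation.map_smul,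
        smul_comm _ t, smul_assoc]),
  fun X => by
    have hsq : ξ.1 (crd D 0 X * crd D 0 X) = 0 :=
      ξ.2.1 _ (Submodule.subset_span ⟨crd D 0 X, by simp [sq]⟩)
    simp only [LinearMap.mk₂_apply, hsq, add_self_eq_zero (K := K), map_zero]⟩

end Cochains

end CurrentLie

end

/-!
An element of the extended algebra is given by its coordinates: three elements of `A`, belonging to
`e`, `h`, `f`, and one scalar, belonging to `D`. As the grading is concentrated in degrees `-1`,
`0`, `1`, a cocycle of positive weight has few components, and each of these is a linear or bilinear
map on `A`. The cocycle equation, evaluated on homogeneous generators, is a system of functional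
equations for these maps, and putting `1` for suitable arguments solves it completely.

* In weight `1` the solutions are exactly the coboundaries (`mem_B2_of_mem_Z2Wt_one`).
* In weight at least `3` the only solution is `0` (`eq_zero_of_mem_Z2Wt`).
* In weight `2` let `(e ⊗ a) ∧ (e ⊗ b) ↦ h ⊗ α(a, b) + β(a, b)D`, `(e ⊗ a) ∧ (h ⊗ b) ↦ f ⊗ γ(a, b)`,
  `(e ⊗ a) ∧ D ↦ f ⊗ δ(a)`. Then `β(a, b) = ξ(ab)` with `ξ(a) = β(a, 1)`. After subtraction of the
  coboundary of `e ⊗ a ↦ f ⊗ α(a, 1)` one finds `α = 0`, `γ(a, b) = abv + ξ(b)D(a)` with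
  `v = γ(1, 1)` and `δ(a) = aw` with `w = δ(1)`; the remaining equations say that `D(v) = 0` and
  `ξ ∈ Ξ_{D,0}` (`exists_parameters_of_weight_two`, `sub_mem_B2_of_mem_Z2Wt_two`).

Conversely the cochains of the three families are cocycles of weight `2`, the second one is a
coboundary for `w ∈ D(A)` (`cochainII_mem_B2`), and there are no other relations
(`parameters_eq_zero_of_mem_B2`): a coboundary has no `D`-component on `(e ⊗ a) ∧ (e ⊗ 1)`, so
`ξ = 0`, and evaluation on `(e ⊗ a) ∧ (h ⊗ b)` and `(e ⊗ 1) ∧ D` gives `v = 0` and `w ∈ D(A)`.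
-/

noncomputable section

namespace CurrentLie

/-! ### Linear algebra in characteristic two -/

section CharTwo

variable (K : Type*) [Field K] [CharP K 2]

theorem neg_eq_self {V : Type*} [AddCommGroup V] [Module K V] (x : V) : -x = x :=
  neg_eq_of_add_eq_zero_left (add_self_eq_zero (K := K) x)

theorem sub_eq_add_of_charTwo {V : Type*} [AddCommGroup V] [Module K V] (x y : V) :
    x - y = x + y := by
  rw [sub_eq_add_neg, neg_eq_self K]

theorem eq_of_add_eq_zero_of_charTwo {V : Type*} [AddCommGroup V] [Module K V] {x y : V}
    (h : x + y = 0) : x = y := by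
  rwa [← sub_eq_add_of_charTwo K, sub_eq_zero] at h

theorem two_eq_zero_of_algebra (A : Type*) [CommRing A] [Algebra K A] : (2 : A) = 0 := by
  rw [← one_add_one_eq_two, add_self_eq_zero (K := K)]

end CharTwo

/-! ### Coordinates and brackets in the extended algebra -/

section EssTable

variable {K : Type*} [Field K]

@[simp] theorem Ess.e_zero : Ess.e K 0 = 1 := rfl
@[simp] theorem Ess.e_one : Ess.e K 1 = 0 := rfl
@[simp] theorem Ess.e_two : Ess.e K 2 = 0 := rfl
@[simp] theorem Ess.h_zero : Ess.h K 0 = 0 := rfl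
@[simp] theorem Ess.h_one : Ess.h K 1 = 1 := rfl
@[simp] theorem Ess.h_two : Ess.h K 2 = 0 := rfl
@[simp] theorem Ess.f_zero : Ess.f K 0 = 0 := rfl
@[simp] theorem Ess.f_one : Ess.f K 1 = 0 := rfl
@[simp] theorem Ess.f_two : Ess.f K 2 = 1 := rfl

variable [CharP K 2]

theorem Ess.lie_h_e : ⁅Ess.h K, Ess.e K⁆ = Ess.e K := by
  rw [← lie_skew, neg_eq_self K, Ess.lie_e_h]

theorem Ess.lie_h_f : ⁅Ess.h K, Ess.f K⁆ = Ess.f K := by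
  rw [← lie_skew, neg_eq_self K, Ess.lie_f_h]

theorem Ess.lie_f_e : ⁅Ess.f K, Ess.e K⁆ = Ess.h K := by
  rw [← lie_skew, neg_eq_self K, Ess.lie_e_f]

end EssTable

section Coordinates

variable {K A : Type*} [Field K] [CommRing A] [Algebra K A] [CharP K 2] (D : Derivation K A A)

@[simp]
theorem crd_cur (i : Fin 3) (x : Ess K) (a : A) : crd D i (cur x a) = x i • a := rfl

@[simp]
theorem dcoef_cur (x : Ess K) (a : A) : dcoef D (cur x a) = 0 := rfl

@[simp]
theorem crd_line (i : Fin 3) (c : K) : crd D i (line D c) = 0 := by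
  change (TensorProduct.rid K A) (LinearMap.lTensor A (Ess.coord i) 0) = 0
  rw [map_zero, map_zero]

@[simp]
theorem dcoef_line (c : K) : dcoef D (line D c) = c := rfl

variable {D} in
theorem eq_sum_coordinates (X : Ext D) :
    X = cur (Ess.e K) (crd D 0 X) + cur (Ess.h K) (crd D 1 X) + cur (Ess.f K) (crd D 2 X) +
      line D (dcoef D X) := by
  obtain ⟨T, c⟩ := X
  have hT : T = crd D 0 ⟨T, c⟩ ⊗ₜ[K] Ess.e K + crd D 1 ⟨T, c⟩ ⊗ₜ[K] Ess.h K +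
      crd D 2 ⟨T, c⟩ ⊗ₜ[K] Ess.f K := by
    change T = (TensorProduct.rid K A) (LinearMap.lTensor A (Ess.coord 0) T) ⊗ₜ[K] Ess.e K +
      (TensorProduct.rid K A) (LinearMap.lTensor A (Ess.coord 1) T) ⊗ₜ[K] Ess.h K +
      (TensorProduct.rid K A) (LinearMap.lTensor A (Ess.coord 2) T) ⊗ₜ[K] Ess.f K
    induction T using TensorProduct.induction_on with
    | zero => simp
    | add T T' hT hT' =>
      simp only [map_add, TensorProduct.add_tmul]
      nth_rewrite 1 [hT, hT']
      abel
    | tmul a x =>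
      simp only [LinearMap.lTensor_tmul, TensorProduct.rid_tmul, TensorProduct.smul_tmul,
        ← TensorProduct.tmul_add]
      congr 1
      apply Ess.ext <;> simp [Ess.coord] <;> rfl
  have h1 : (⟨T, c⟩ : Ext D) = ⟨T, 0⟩ + ⟨0, c⟩ := by
    rw [LieAlgebra.SemiDirectSum.add_eq_mk, add_zero, zero_add]
  nth_rewrite 1 [h1]
  congr 1
  nth_rewrite 1 [hT]
  change LieAlgebra.SemiDirectSum.inl (action D) _ = _
  rw [map_add, map_add]
  rfl

variable {D} in
theorem ext_coordinates {X Y : Ext D} (h0 : crd D 0 X = crd D 0 Y) (h1 : crd D 1 X = crd D 1 Y)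
    (h2 : crd D 2 X = crd D 2 Y) (hd : dcoef D X = dcoef D Y) : X = Y := by
  rw [eq_sum_coordinates X, eq_sum_coordinates Y, h0, h1, h2, hd]

theorem lie_cur_cur (x y : Ess K) (a b : A) :
    ⁅(cur x a : Ext D), (cur y b : Ext D)⁆ = cur ⁅x, y⁆ (a * b) := by
  change ⁅LieAlgebra.SemiDirectSum.inl (action D) (a ⊗ₜ[K] x),
    LieAlgebra.SemiDirectSum.inl (action D) (b ⊗ₜ[K] y)⁆ = _
  rw [← LieHom.map_lie, LieAlgebra.ExtendScalars.bracket_tmul]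
  rfl

theorem lie_line_cur (c : K) (x : Ess K) (a : A) :
    ⁅line D c, (cur x a : Ext D)⁆ = cur x (c • D a) := by
  change (⟨⁅(0 : A ⊗[K] Ess K), a ⊗ₜ[K] x⁆ + action D (Line.ofScalar D c) (a ⊗ₜ[K] x) -
    action D 0 0, ⁅Line.ofScalar D c, 0⁆⟩ : Ext D) = _
  have h : ⁅(0 : A ⊗[K] Ess K), a ⊗ₜ[K] x⁆ = 0 := zero_lie (L := A ⊗[K] Ess K) (a ⊗ₜ[K] x)
  rw [h, zero_add, map_zero (action D (0 : Line D)), sub_zero, Line.lie_def]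
  rfl

theorem lie_cur_line (c : K) (x : Ess K) (a : A) :
    ⁅(cur x a : Ext D), line D c⁆ = cur x (c • D a) := by
  rw [← lie_skew, neg_eq_self K, lie_line_cur]

theorem lie_line_line (c c' : K) : ⁅line D c, line D c'⁆ = 0 := by
  change ⁅LieAlgebra.SemiDirectSum.inr (action D) (Line.ofScalar D c),
    LieAlgebra.SemiDirectSum.inr (action D) (Line.ofScalar D c')⁆ = _
  rw [← LieHom.map_lie, Line.lie_def, map_zero]

variable {D} in
theorem cur_zero_left (a : A) : (cur (0 : Ess K) a : Ext D) = 0 := by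
  apply ext_coordinates <;> simp only [crd_cur, dcoef_cur, map_zero, Ess.zero_apply, zero_smul]

theorem crd_zero_lie (X Y : Ext D) : crd D 0 ⁅X, Y⁆ = crd D 0 X * crd D 1 Y + crd D 1 X * crd D 0 Y
    + dcoef D X • D (crd D 0 Y) + dcoef D Y • D (crd D 0 X) := by
  nth_rewrite 1 [eq_sum_coordinates X, eq_sum_coordinates Y]
  simp only [add_lie, lie_add, lie_cur_cur, lie_line_cur, lie_cur_line, lie_line_line, map_add,
    crd_cur, map_zero]
  simp [Ess.lie_def, neg_eq_self K]
  abel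

theorem crd_one_lie (X Y : Ext D) : crd D 1 ⁅X, Y⁆ = crd D 0 X * crd D 2 Y + crd D 2 X * crd D 0 Y
    + dcoef D X • D (crd D 1 Y) + dcoef D Y • D (crd D 1 X) := by
  nth_rewrite 1 [eq_sum_coordinates X, eq_sum_coordinates Y]
  simp only [add_lie, lie_add, lie_cur_cur, lie_line_cur, lie_cur_line, lie_line_line, map_add,
    crd_cur, map_zero]
  simp [Ess.lie_def, neg_eq_self K]
  abel

theorem crd_two_lie (X Y : Ext D) : crd D 2 ⁅X, Y⁆ = crd D 2 X * crd D 1 Y + crd D 1 X * crd D 2 Y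
    + dcoef D X • D (crd D 2 Y) + dcoef D Y • D (crd D 2 X) := by
  nth_rewrite 1 [eq_sum_coordinates X, eq_sum_coordinates Y]
  simp only [add_lie, lie_add, lie_cur_cur, lie_line_cur, lie_cur_line, lie_line_line, map_add,
    crd_cur, map_zero]
  simp [Ess.lie_def, neg_eq_self K]
  abel

theorem dcoef_lie (X Y : Ext D) : dcoef D ⁅X, Y⁆ = 0 := by
  nth_rewrite 1 [eq_sum_coordinates X, eq_sum_coordinates Y]
  simp only [add_lie, lie_add, lie_cur_cur, lie_line_cur, lie_cur_line, lie_line_line, map_add,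
    dcoef_cur, add_zero]

end Coordinates

/-! ### The grading in coordinates -/

section Grading

variable {K A : Type*} [Field K] [CommRing A] [Algebra K A] [CharP K 2] {D : Derivation K A A}

theorem cur_e_mem_grading (a : A) : cur (Ess.e K) a ∈ grading D (-1) := by
  rw [grading, if_pos rfl]
  exact ⟨a, rfl⟩

theorem cur_h_mem_grading (a : A) : cur (Ess.h K) a ∈ grading D 0 := by
  rw [grading, if_neg (by decide), if_pos rfl]
  exact Submodule.mem_sup_left ⟨a, rfl⟩

theorem line_mem_grading (c : K) : line D c ∈ grading D 0 := by
  rw [grading, if_neg (by decide), if_pos rfl]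
  exact Submodule.mem_sup_right ⟨c, rfl⟩

theorem cur_f_mem_grading (a : A) : cur (Ess.f K) a ∈ grading D 1 := by
  rw [grading, if_neg (by decide), if_neg (by decide), if_pos rfl]
  exact ⟨a, rfl⟩

theorem mem_grading_neg_one {X : Ext D} :
    X ∈ grading D (-1) ↔ crd D 1 X = 0 ∧ crd D 2 X = 0 ∧ dcoef D X = 0 := by
  constructor
  · rw [grading, if_pos rfl]
    rintro ⟨a, rfl⟩
    simp
  · rintro ⟨h1, h2, hd⟩
    rw [eq_sum_coordinates X, h1, h2, hd]
    simpa only [map_zero, add_zero] using cur_e_mem_grading _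

theorem mem_grading_zero {X : Ext D} :
    X ∈ grading D 0 ↔ crd D 0 X = 0 ∧ crd D 2 X = 0 := by
  constructor
  · rw [grading, if_neg (by decide), if_pos rfl]
    intro hX
    obtain ⟨_, ⟨a, rfl⟩, _, ⟨c, rfl⟩, rfl⟩ := Submodule.mem_sup.1 hX
    simp only [map_add, crd_cur, crd_line, Ess.h_zero, Ess.h_two, zero_smul, add_zero, and_self]
  · rintro ⟨h0, h2⟩
    rw [eq_sum_coordinates X, h0, h2]
    simpa only [map_zero, add_zero, zero_add] using
      add_mem (cur_h_mem_grading _) (line_mem_grading _)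

theorem mem_grading_one {X : Ext D} :
    X ∈ grading D 1 ↔ crd D 0 X = 0 ∧ crd D 1 X = 0 ∧ dcoef D X = 0 := by
  constructor
  · rw [grading, if_neg (by decide), if_neg (by decide), if_pos rfl]
    rintro ⟨a, rfl⟩
    simp
  · rintro ⟨h0, h1, hd⟩
    rw [eq_sum_coordinates X, h0, h1, hd]
    simpa only [map_zero, add_zero, zero_add] using cur_f_mem_grading _

theorem grading_eq_bot {n : ℤ} (hn : 1 < |n|) : grading D n = ⊥ := by
  rw [grading, if_neg, if_neg, if_neg] <;> rintro rfl <;> simp at hn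

theorem homogeneous_cases {i : ℤ} {X : Ext D} (hX : X ∈ grading D i) :
    (i = -1 ∧ ∃ a, X = cur (Ess.e K) a) ∨ (i = 0 ∧ ∃ a c, X = cur (Ess.h K) a + line D c) ∨
      (i = 1 ∧ ∃ a, X = cur (Ess.f K) a) ∨ X = 0 := by
  rw [grading] at hX
  split_ifs at hX with h1 h2 h3
  · obtain ⟨a, rfl⟩ := hX
    exact Or.inl ⟨h1, a, rfl⟩
  · obtain ⟨_, ⟨a, rfl⟩, _, ⟨c, rfl⟩, rfl⟩ := Submodule.mem_sup.1 hX
    exact Or.inr (Or.inl ⟨h2, a, c, rfl⟩)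
  · obtain ⟨a, rfl⟩ := hX
    exact Or.inr (Or.inr (Or.inl ⟨h3, a, rfl⟩))
  · exact Or.inr (Or.inr (Or.inr hX))

theorem eq_cur_e_of_mem {X : Ext D} (hX : X ∈ grading D (-1)) :
    X = cur (Ess.e K) (crd D 0 X) := by
  obtain ⟨h1, h2, hd⟩ := mem_grading_neg_one.1 hX
  nth_rewrite 1 [eq_sum_coordinates X, h1, h2, hd]
  simp only [map_zero, add_zero]

theorem eq_cur_h_add_line_of_mem {X : Ext D} (hX : X ∈ grading D 0) :
    X = cur (Ess.h K) (crd D 1 X) + line D (dcoef D X) := by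
  obtain ⟨h0, h2⟩ := mem_grading_zero.1 hX
  nth_rewrite 1 [eq_sum_coordinates X, h0, h2]
  simp only [map_zero, add_zero, zero_add]

theorem eq_cur_f_of_mem {X : Ext D} (hX : X ∈ grading D 1) : X = cur (Ess.f K) (crd D 2 X) := by
  obtain ⟨h0, h1, hd⟩ := mem_grading_one.1 hX
  nth_rewrite 1 [eq_sum_coordinates X, h0, h1, hd]
  simp only [map_zero, zero_add, add_zero]

end Grading

/-! ### Cocycles and coboundaries in characteristic two -/

section Cocycles

variable {K L : Type*} [Field K] [CharP K 2] [LieRing L] [LieAlgebra K L]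

/-- The signs in the Chevalley-Eilenberg differential disappear, so that the cocycle equation
becomes invariant under cyclic permutations of its three arguments. -/
theorem mem_Z2_iff {φ : L →ₗ[K] L →ₗ[K] L} :
    φ ∈ Z2 K L L ↔ (∀ X, φ X X = 0) ∧ ∀ X Y Z, φ ⁅X, Y⁆ Z + φ ⁅Y, Z⁆ X + φ ⁅Z, X⁆ Y +
      ⁅φ X Y, Z⁆ + ⁅φ Y Z, X⁆ + ⁅φ Z X, Y⁆ = 0 := by
  have key (c : twoCochain K L L) (X Y Z : L) : d₂₃ K L L c X Y Z =
      c.1 ⁅X, Y⁆ Z + c.1 ⁅Y, Z⁆ X + c.1 ⁅Z, X⁆ Y +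
        ⁅c.1 X Y, Z⁆ + ⁅c.1 Y Z, X⁆ + ⁅c.1 Z X, Y⁆ := by
    rw [d₂₃_apply, ← twoCochain_skew c Z X, ← lie_skew Z X, ← lie_skew (c.1 X Y),
      ← lie_skew (c.1 Y Z), ← lie_skew (c.1 Z X)]
    simp only [sub_eq_add_of_charTwo K, neg_eq_self K, twoCochain_val_apply]
    abel
  constructor
  · rintro ⟨c, hc, rfl⟩
    refine ⟨c.2, fun X Y Z => ?_⟩
    have := (mem_twoCocycle_iff K L L c).1 hc
    rw [Submodule.coe_subtype, ← key, this]
    rfl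
  · rintro ⟨hφ, h⟩
    refine ⟨⟨φ, hφ⟩, (mem_twoCocycle_iff K L L _).2 ?_, rfl⟩
    ext X Y Z
    rw [key, h]
    rfl

theorem d₁₂_apply_eq (ψ : L →ₗ[K] L) (X Y : L) :
    (d₁₂ K L L ψ).1 X Y = ⁅ψ X, Y⁆ + ⁅X, ψ Y⁆ + ψ ⁅X, Y⁆ := by
  rw [twoCochain_val_apply, d₁₂_apply_apply, ← lie_skew (ψ X)]
  simp only [sub_eq_add_of_charTwo K, neg_eq_self K]
  abel

theorem mem_B2_iff {φ : L →ₗ[K] L →ₗ[K] L} :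
    φ ∈ B2 K L L ↔ ∃ ψ : L →ₗ[K] L, ∀ X Y, φ X Y = ⁅ψ X, Y⁆ + ⁅X, ψ Y⁆ + ψ ⁅X, Y⁆ := by
  constructor
  · rintro ⟨_, ⟨ψ, rfl⟩, rfl⟩
    exact ⟨ψ, d₁₂_apply_eq ψ⟩
  · rintro ⟨ψ, h⟩
    refine ⟨_, ⟨ψ, rfl⟩, LinearMap.ext fun X => LinearMap.ext fun Y => ?_⟩
    rw [h, ← d₁₂_apply_eq]
    rfl

theorem apply_comm_of_alternating {φ : L →ₗ[K] L →ₗ[K] L} (hφ : ∀ X, φ X X = 0) (X Y : L) :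
    φ X Y = φ Y X := by
  have h := twoCochain_skew (⟨φ, hφ⟩ : twoCochain K L L) Y X
  rw [neg_eq_self K] at h
  exact h.symm

end Cocycles

/-! ### The three families of cocycles -/

section BasicCocycles

variable {K A : Type*} [Field K] [CommRing A] [Algebra K A] [CharP K 2] {D : Derivation K A A}

/-- A cocycle that vanishes on pairs without `e`-component has weight `2` as soon as the weight
condition holds on the pairs of homogeneous elements whose first member lies in `e ⊗ A`. -/
theorem mem_Z2Wt_two {φ : Ext D →ₗ[K] Ext D →ₗ[K] Ext D} (hφ : φ ∈ Z2 K (Ext D) (Ext D))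
    (hee : ∀ a b, φ (cur (Ess.e K) a) (cur (Ess.e K) b) ∈ grading D 0)
    (he : ∀ a b c, φ (cur (Ess.e K) a) (cur (Ess.h K) b + line D c) ∈ grading D 1)
    (hef : ∀ a b, φ (cur (Ess.e K) a) (cur (Ess.f K) b) = 0)
    (h0 : ∀ X Y, crd D 0 X = 0 → crd D 0 Y = 0 → φ X Y = 0) :
    φ ∈ Z2Wt (grading D) (grading D) 2 := by
  have hs := apply_comm_of_alternating (mem_Z2_iff.1 hφ).1
  have hh (a : A) (c : K) : crd D 0 (cur (Ess.h K) a + line D c) = 0 := by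
    rw [map_add, crd_cur, crd_line, Ess.h_zero, zero_smul, add_zero]
  have hf (a : A) : crd D 0 (cur (Ess.f K) a) = 0 := by rw [crd_cur, Ess.f_zero, zero_smul]
  refine ⟨hφ, fun i j X hX Y hY => ?_⟩
  rcases homogeneous_cases hX with ⟨rfl, a, rfl⟩ | ⟨rfl, a, c, rfl⟩ | ⟨rfl, a, rfl⟩ | rfl
  · rcases homogeneous_cases hY with ⟨rfl, b, rfl⟩ | ⟨rfl, b, c', rfl⟩ | ⟨rfl, b, rfl⟩ | rfl
    · exact hee a b
    · exact he a b c'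
    · exact hef a b ▸ zero_mem _
    · rw [map_zero]; exact zero_mem _
  · rcases homogeneous_cases hY with ⟨rfl, b, rfl⟩ | ⟨rfl, b, c', rfl⟩ | ⟨rfl, b, rfl⟩ | rfl
    · rw [hs]; exact he b a c
    · rw [h0 _ _ (hh a c) (hh b c')]; exact zero_mem _
    · rw [h0 _ _ (hh a c) (hf b)]; exact zero_mem _
    · rw [map_zero]; exact zero_mem _
  · rcases homogeneous_cases hY with ⟨rfl, b, rfl⟩ | ⟨rfl, b, c', rfl⟩ | ⟨rfl, b, rfl⟩ | rfl
    · rw [hs, hef]; exact zero_mem _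
    · rw [h0 _ _ (hf a) (hh b c')]; exact zero_mem _
    · rw [h0 _ _ (hf a) (hf b)]; exact zero_mem _
    · rw [map_zero]; exact zero_mem _
  · rw [map_zero, LinearMap.zero_apply]; exact zero_mem _

theorem cochainI_apply (v : A) (X Y : Ext D) : (cochainI D v).1 X Y =
    cur (Ess.f K) (crd D 0 X * crd D 1 Y * v + crd D 0 Y * crd D 1 X * v) := rfl

theorem cochainII_apply (w : A) (X Y : Ext D) : (cochainII D w).1 X Y =
    cur (Ess.f K) (dcoef D Y • (crd D 0 X * w) + dcoef D X • (crd D 0 Y * w)) := rfl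

theorem cochainIII_apply (ξ : Xi D (⊥ : Submodule K A)) (X Y : Ext D) : (cochainIII D ξ).1 X Y =
    line D (ξ.1 (crd D 0 X * crd D 0 Y)) +
      cur (Ess.f K) (ξ.1 (crd D 1 Y) • D (crd D 0 X) + ξ.1 (crd D 1 X) • D (crd D 0 Y)) := rfl

theorem cochainI_mem_Z2Wt {v : A} (hv : v ∈ invariants D) :
    (cochainI D v).1 ∈ Z2Wt (grading D) (grading D) 2 := by
  have h2 := two_eq_zero_of_algebra K A
  have hv : D v = 0 := hv
  apply mem_Z2Wt_two
  · refine mem_Z2_iff.2 ⟨(cochainI D v).2, fun X Y Z => ?_⟩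
    apply ext_coordinates
    all_goals
      simp only [cochainI_apply, map_add, crd_zero_lie, crd_one_lie, crd_two_lie, dcoef_lie,
        crd_cur, dcoef_cur, Ess.f_zero, Ess.f_one, Ess.f_two, zero_smul, one_smul, map_zero,
        Derivation.leibniz, hv, smul_eq_mul, add_zero]
    all_goals simp only [Algebra.smul_def]
    all_goals grind
  · intros
    simp only [cochainI_apply, mem_grading_zero, crd_cur, Ess.e_zero, Ess.e_one, zero_smul,
      map_zero, mul_zero, zero_mul, add_zero, and_self]
  · intros
    simp only [cochainI_apply, mem_grading_one, map_add, crd_cur, crd_line, dcoef_cur, Ess.e_zero,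
      Ess.e_one, Ess.h_zero, Ess.h_one, Ess.f_zero, Ess.f_one, zero_smul, map_zero, mul_zero,
      zero_mul, add_zero, and_self]
  · intros
    simp only [cochainI_apply, crd_cur, Ess.e_zero, Ess.e_one, Ess.f_zero, Ess.f_one, zero_smul,
      map_zero, mul_zero, zero_mul, add_zero]
  · intro X Y hX hY
    simp only [cochainI_apply, hX, hY, zero_mul, map_zero, add_zero]

theorem cochainII_mem_Z2Wt (w : A) : (cochainII D w).1 ∈ Z2Wt (grading D) (grading D) 2 := by
  have h2 := two_eq_zero_of_algebra K A
  apply mem_Z2Wt_two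
  · refine mem_Z2_iff.2 ⟨(cochainII D w).2, fun X Y Z => ?_⟩
    apply ext_coordinates
    all_goals
      simp only [cochainII_apply, map_add, crd_zero_lie, crd_one_lie, crd_two_lie, dcoef_lie,
        crd_cur, dcoef_cur, Ess.f_zero, Ess.f_one, Ess.f_two, zero_smul, one_smul, map_zero,
        Derivation.leibniz, smul_eq_mul, Derivation.map_smul, add_zero]
    all_goals simp only [Algebra.smul_def]
    all_goals grind
  · intros
    simp only [cochainII_apply, mem_grading_zero, crd_cur, dcoef_cur, Ess.e_zero, zero_smul,
      map_zero, add_zero, and_self]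
  · intros
    simp only [cochainII_apply, mem_grading_one, map_add, crd_cur, crd_line, dcoef_cur, dcoef_line,
      Ess.e_zero, Ess.h_zero, Ess.f_zero, Ess.f_one, zero_smul, smul_zero, map_zero, zero_mul,
      add_zero, zero_add, and_self]
  · intros
    simp only [cochainII_apply, crd_cur, dcoef_cur, Ess.e_zero, Ess.f_zero, zero_smul, smul_zero,
      map_zero, zero_mul, add_zero]
  · intro X Y hX hY
    simp only [cochainII_apply, hX, hY, zero_mul, smul_zero, map_zero, add_zero]

theorem Xi.apply_smul_comm {ξ : A →ₗ[K] K} (hξ : ξ ∈ Xi D (⊥ : Submodule K A)) (a b : A) :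
    ξ a • D b = ξ b • D a :=
  eq_of_add_eq_zero_of_charTwo K ((Submodule.mem_bot K).1 (hξ.2.2.2.1 a b))

/-- The form in which the symmetry `ξ(a)D(b) = ξ(b)D(a)` enters the cocycle equation for the third
family: all values of `ξ` on products are eliminated. -/
theorem Xi.apply_mul_smul {ξ : A →ₗ[K] K} (hξ : ξ ∈ Xi D (⊥ : Submodule K A)) (a b c : A) :
    ξ (a * b) • D c = ξ c • (a * D b + b * D a) := by
  rw [Xi.apply_smul_comm hξ, Derivation.leibniz]
  rfl

theorem cochainIII_mem_Z2Wt (ξ : Xi D (⊥ : Submodule K A)) :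
    (cochainIII D ξ).1 ∈ Z2Wt (grading D) (grading D) 2 := by
  have h2 := two_eq_zero_of_algebra K A
  obtain ⟨ξ, hξ⟩ := ξ
  apply mem_Z2Wt_two
  · refine mem_Z2_iff.2 ⟨(cochainIII D ⟨ξ, hξ⟩).2, fun X Y Z => ?_⟩
    have hc := Xi.apply_smul_comm hξ
    have hD (a : A) : ξ (D a) = 0 := hξ.2.1 _ ⟨a, rfl⟩
    apply ext_coordinates
    · simp only [cochainIII_apply, map_add, crd_zero_lie, crd_cur, crd_line, dcoef_cur, dcoef_line,
        Ess.f_zero, Ess.f_one, zero_smul, map_zero, add_zero, Xi.apply_mul_smul hξ]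
      have := hc (crd D 0 X) (crd D 0 Y)
      have := hc (crd D 0 X) (crd D 0 Z)
      have := hc (crd D 0 Y) (crd D 0 Z)
      simp only [Algebra.smul_def] at *
      grind
    · simp only [cochainIII_apply, map_add, crd_one_lie, crd_cur, crd_line, dcoef_cur, dcoef_line,
        Ess.f_zero, Ess.f_one, Ess.f_two, zero_smul, one_smul, map_zero, add_zero,
        Xi.apply_mul_smul hξ]
      simp only [Algebra.smul_def] at *
      grind
    · simp only [cochainIII_apply, map_add, crd_zero_lie, crd_one_lie, crd_two_lie, crd_cur,
        crd_line, dcoef_cur, dcoef_line, Derivation.leibniz, Derivation.map_smul,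
        Ess.f_one, Ess.f_two, zero_smul, one_smul, map_zero, map_smul,
        hD, Xi.apply_mul_smul hξ, smul_eq_mul, add_smul, mul_zero, add_zero]
      have := hc (crd D 1 X) (crd D 1 Y)
      have := hc (crd D 1 X) (crd D 1 Z)
      have := hc (crd D 1 Y) (crd D 1 Z)
      simp only [Algebra.smul_def] at *
      grind
    -- The `D`-coefficient vanishes because `ξ` kills `D(ab)`, that is, `ξ(D(a)b) = ξ(D(b)a)`.
    · simp only [cochainIII_apply, map_add, crd_zero_lie, dcoef_cur, dcoef_line, dcoef_lie,
        map_zero, add_zero, add_mul, map_smul, smul_mul_assoc]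
      have h (a b : A) : ξ (D a * b) = ξ (D b * a) := by
        have := hD (a * b)
        rw [Derivation.leibniz, map_add, add_comm, ← sub_eq_add_of_charTwo K, sub_eq_zero,
          smul_eq_mul, smul_eq_mul, mul_comm b, mul_comm a] at this
        exact this
      rw [h (crd D 0 X) (crd D 0 Y), h (crd D 0 X) (crd D 0 Z), h (crd D 0 Y) (crd D 0 Z)]
      simp only [mul_comm, mul_left_comm]
      have h2 : (2 : K) = 0 := CharTwo.two_eq_zero
      simp only [Algebra.smul_def]
      grind
  · intros
    simp only [cochainIII_apply, mem_grading_zero, crd_cur, crd_line, Ess.e_zero, Ess.e_one,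
      zero_smul, map_zero, add_zero, and_self]
  · intros
    simp only [cochainIII_apply, mem_grading_one, map_add, crd_cur, crd_line, dcoef_cur,
      Ess.e_zero, Ess.e_one, Ess.h_zero, Ess.h_one, Ess.f_zero, Ess.f_one, zero_smul, smul_zero,
      map_zero, mul_zero, add_zero, zero_add, and_self]
  · intros
    simp only [cochainIII_apply, crd_cur, Ess.e_zero, Ess.e_one, Ess.f_zero, Ess.f_one, zero_smul,
      smul_zero, map_zero, mul_zero, add_zero]
  · intro X Y hX hY
    simp only [cochainIII_apply, hX, hY, zero_mul, smul_zero, map_zero, add_zero]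

end BasicCocycles

/-! ### An alternating map is determined by its values on the homogeneous generators -/

section Separation

variable {K A : Type*} [Field K] [CommRing A] [Algebra K A] [CharP K 2] {D : Derivation K A A}

/-- The hypotheses compare the two maps on pairs of generators, `d` in their names standing for `D`.
Pairs in the opposite order are covered by alternation, multiples of `D` by linearity. -/
theorem eq_of_alternating {φ φ' : Ext D →ₗ[K] Ext D →ₗ[K] Ext D}
    (hφ : ∀ X, φ X X = 0) (hφ' : ∀ X, φ' X X = 0)
    (hee : ∀ a b, φ (cur (Ess.e K) a) (cur (Ess.e K) b) = φ' (cur (Ess.e K) a) (cur (Ess.e K) b))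
    (heh : ∀ a b, φ (cur (Ess.e K) a) (cur (Ess.h K) b) = φ' (cur (Ess.e K) a) (cur (Ess.h K) b))
    (hed : ∀ a, φ (cur (Ess.e K) a) (line D 1) = φ' (cur (Ess.e K) a) (line D 1))
    (hhh : ∀ a b, φ (cur (Ess.h K) a) (cur (Ess.h K) b) = φ' (cur (Ess.h K) a) (cur (Ess.h K) b))
    (hhd : ∀ a, φ (cur (Ess.h K) a) (line D 1) = φ' (cur (Ess.h K) a) (line D 1))
    (hef : ∀ a b, φ (cur (Ess.e K) a) (cur (Ess.f K) b) = φ' (cur (Ess.e K) a) (cur (Ess.f K) b))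
    (hhf : ∀ a b, φ (cur (Ess.h K) a) (cur (Ess.f K) b) = φ' (cur (Ess.h K) a) (cur (Ess.f K) b))
    (hfd : ∀ a, φ (cur (Ess.f K) a) (line D 1) = φ' (cur (Ess.f K) a) (line D 1))
    (hff : ∀ a b, φ (cur (Ess.f K) a) (cur (Ess.f K) b) = φ' (cur (Ess.f K) a) (cur (Ess.f K) b)) :
    φ = φ' := by
  have hs := apply_comm_of_alternating hφ
  have hs' := apply_comm_of_alternating hφ'
  have hline (c : K) : line D c = c • line D 1 := by rw [← map_smul, smul_eq_mul, mul_one]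
  refine LinearMap.ext fun X => LinearMap.ext fun Y => ?_
  rw [eq_sum_coordinates X, eq_sum_coordinates Y, hline (dcoef D X), hline (dcoef D Y)]
  simp only [map_add, LinearMap.add_apply, map_smul, LinearMap.smul_apply]
  simp only [hs (line D 1), hs' (line D 1), hs (cur (Ess.f K) _) (cur (Ess.e K) _),
    hs' (cur (Ess.f K) _) (cur (Ess.e K) _), hs (cur (Ess.f K) _) (cur (Ess.h K) _),
    hs' (cur (Ess.f K) _) (cur (Ess.h K) _), hs (cur (Ess.h K) _) (cur (Ess.e K) _),
    hs' (cur (Ess.h K) _) (cur (Ess.e K) _), hee, heh, hed, hhh, hhd, hef, hhf, hfd, hff, hφ, hφ']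

end Separation

/-! ### Cocycles of weight two -/

section WeightTwo

variable {K A : Type*} [Field K] [CommRing A] [Algebra K A] [CharP K 2] {D : Derivation K A A}

/-- The general solution of the cocycle equations in weight `2`, where the components of the cocycle
are `(e ⊗ a) ∧ (e ⊗ b) ↦ h ⊗ α(a, b) + β(a, b)D`, `(e ⊗ a) ∧ (h ⊗ b) ↦ f ⊗ γ(a, b)` and
`(e ⊗ a) ∧ D ↦ f ⊗ δ(a)`. The hypotheses are named after the basis elements on which the cocycle
equation is evaluated. The map `s` is the coboundary part. -/
theorem exists_parameters_of_weight_two {α γ : A →ₗ[K] A →ₗ[K] A} {β : A →ₗ[K] A →ₗ[K] K}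
    {δ : A →ₗ[K] A} (hα : ∀ a, α a a = 0) (hβ : ∀ a, β a a = 0)
    (heee : ∀ a b c, α a b * c + β a b • D c + (α b c * a + β b c • D a) +
      (α c a * b + β c a • D b) = 0)
    (heeh : ∀ a b c, β (b * c) a + β (c * a) b = 0)
    (heef : ∀ a b c, γ a (b * c) + γ b (c * a) + (α a b * c + β a b • D c) = 0)
    (heed : ∀ a b, β (D b) a + β (D a) b = 0)
    (hehh : ∀ a b c, γ (a * b) c + γ (c * a) b + γ a b * c + γ a c * b = 0)
    (hehd : ∀ a b, δ (a * b) + γ a (D b) + γ (D a) b + D (γ a b) + δ a * b = 0) :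
    ∃ v ∈ invariants D, ∃ (w : A) (ξ : Xi D (⊥ : Submodule K A)) (s : A →ₗ[K] A),
      (∀ a b, α a b = s a * b + a * s b) ∧ (∀ a b, β a b = ξ.1 (a * b)) ∧
      (∀ a b, γ a b = a * b * v + ξ.1 b • D a + s a * b + s (a * b)) ∧
      ∀ a, δ a = a * w + D (s a) + s (D a) := by
  have h2 := two_eq_zero_of_algebra K A
  have hα' a b : α a b = α b a := by
    have := hα (a + b)
    simp only [map_add, LinearMap.add_apply, hα, zero_add, add_zero] at this
    exact (eq_of_add_eq_zero_of_charTwo K this).symm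
  obtain ⟨ξ, hξ⟩ : ∃ ξ : A →ₗ[K] K, ∀ a, ξ a = β a 1 := ⟨β.flip 1, fun a => rfl⟩
  obtain ⟨s, hs⟩ : ∃ s : A →ₗ[K] A, ∀ a, s a = α a 1 := ⟨α.flip 1, fun a => rfl⟩
  have hβξ a b : β a b = ξ (a * b) := by
    have := eq_of_add_eq_zero_of_charTwo K (heeh b 1 a)
    rw [one_mul] at this
    rw [this, hξ]
  have hξD a : ξ (D a) = 0 := by
    have := heed 1 a
    rwa [D.map_one_eq_zero, map_zero, LinearMap.zero_apply, add_zero, ← hξ] at this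
  have hξsq a : ξ (a * a) = 0 := by rw [← hβξ, hβ]
  have hαs a b : α a b = s a * b + s b * a + ξ a • D b + ξ b • D a := by
    have := heee a b 1
    rw [hβξ b, hβξ 1, hα' 1, ← hs, ← hs, D.map_one_eq_zero, smul_zero, one_mul, mul_one, mul_one]
      at this
    grind
  -- From here on `γ 1 1` plays the role of `v`.
  have hγr a : γ a 1 = a * γ 1 1 := by
    have := hehh 1 a 1
    simp only [one_mul, mul_one] at this
    grind
  have hγl a : γ 1 a = s a + a * γ 1 1 := by
    have := heef 1 a 1
    rw [hα' 1, ← hs, D.map_one_eq_zero, smul_zero, one_mul, mul_one, mul_one, hγr] at this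
    grind
  -- The antisymmetric part of `γ` is determined both by `α` and by `γ 1`; comparing the two
  -- expressions leaves exactly the symmetry condition on `ξ`.
  have hsym a b : ξ a • D b = ξ b • D a := by
    have e1 := heef a b 1
    have e2 := hehh 1 a b
    have e3 := hαs a b
    rw [D.map_one_eq_zero, smul_zero, mul_one, one_mul] at e1
    rw [one_mul, mul_one, hγl, hγl] at e2
    grind
  have hγ a b : γ a b = a * b * γ 1 1 + ξ b • D a + s a * b + s (a * b) := by
    have := heef a 1 b
    rw [one_mul, hγl, ← hs, ← hξ, hsym, mul_comm b] at this
    grind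
  have hDg : D (γ 1 1) = 0 := by
    have := hehd 1 1
    rw [D.map_one_eq_zero, map_zero, map_zero, LinearMap.zero_apply, mul_one] at this
    grind
  refine ⟨γ 1 1, hDg, δ 1, ⟨ξ, ?_, ?_, ?_, ?_, ?_⟩, s, fun a b => ?_, hβξ, hγ, fun a => ?_⟩
  · intro a ha
    induction ha using Submodule.span_induction with
    | mem x hx => obtain ⟨a, rfl⟩ := hx; simpa only [sq] using hξsq a
    | zero => exact map_zero ξ
    | add x y _ _ hx hy => rw [map_add, hx, hy, add_zero]
    | smul t x _ hx => rw [map_smul, hx, smul_zero]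
  · rintro _ ⟨a, rfl⟩
    exact hξD a
  · rintro _ rfl
    exact map_zero ξ
  · intro a b
    rw [hsym, add_self_eq_zero (K := K)]
    exact zero_mem _
  -- Modulo the symmetry condition the terms `ξ(a)b D(c)` cancel in pairs, and what is left is the
  -- cocycle equation on `e ⊗ a`, `e ⊗ b`, `e ⊗ c`.
  · intro a b c
    have e := heee a b c
    have e1 := hsym a b
    have e2 := hsym a c
    have e3 := hsym b c
    rw [hβξ, hβξ, hβξ, hαs, hαs, hαs] at e
    simp only [Algebra.smul_def] at *
    grind
  · rw [hαs, hsym, add_assoc, add_self_eq_zero (K := K), add_zero, mul_comm (s b)]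
  · have := hehd 1 a
    rw [D.map_one_eq_zero, map_zero, LinearMap.zero_apply, hγl (D a), hγl a, map_add,
      Derivation.leibniz, hDg, one_mul] at this
    simp only [smul_eq_mul, mul_zero] at this
    grind

/-- The three families exhaust the cohomology classes of weight `2`. -/
theorem sub_mem_B2_of_mem_Z2Wt_two {φ : Ext D →ₗ[K] Ext D →ₗ[K] Ext D}
    (hφ : φ ∈ Z2Wt (grading D) (grading D) 2) :
    ∃ v ∈ invariants D, ∃ (w : A) (ξ : Xi D (⊥ : Submodule K A)),
      φ - ((cochainI D v).1 + (cochainII D w).1 + (cochainIII D ξ).1) ∈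
        B2 K (Ext D) (Ext D) := by
  obtain ⟨hZ, hW⟩ := hφ
  obtain ⟨halt, hJ⟩ := mem_Z2_iff.1 hZ
  have hs := apply_comm_of_alternating halt
  obtain ⟨α, β, hee⟩ : ∃ (α : A →ₗ[K] A →ₗ[K] A) (β : A →ₗ[K] A →ₗ[K] K),
      ∀ a b, φ (cur (Ess.e K) a) (cur (Ess.e K) b) = cur (Ess.h K) (α a b) + line D (β a b) :=
    ⟨(φ.compl₁₂ (cur (Ess.e K)) (cur (Ess.e K))).compr₂ (crd D 1),
      (φ.compl₁₂ (cur (Ess.e K)) (cur (Ess.e K))).compr₂ (dcoef D), fun a b =>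
      eq_cur_h_add_line_of_mem (hW (-1) (-1) _ (cur_e_mem_grading a) _ (cur_e_mem_grading b))⟩
  obtain ⟨γ, heh⟩ : ∃ γ : A →ₗ[K] A →ₗ[K] A,
      ∀ a b, φ (cur (Ess.e K) a) (cur (Ess.h K) b) = cur (Ess.f K) (γ a b) :=
    ⟨(φ.compl₁₂ (cur (Ess.e K)) (cur (Ess.h K))).compr₂ (crd D 2), fun a b =>
      eq_cur_f_of_mem (hW (-1) 0 _ (cur_e_mem_grading a) _ (cur_h_mem_grading b))⟩
  obtain ⟨δ, hed⟩ : ∃ δ : A →ₗ[K] A,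
      ∀ a, φ (cur (Ess.e K) a) (line D 1) = cur (Ess.f K) (δ a) :=
    ⟨crd D 2 ∘ₗ φ.flip (line D 1) ∘ₗ cur (Ess.e K), fun a =>
      eq_cur_f_of_mem (hW (-1) 0 _ (cur_e_mem_grading a) _ (line_mem_grading 1))⟩
  have hbot {i j : ℤ} (hij : 1 < |i + j + 2|) {X Y : Ext D} (hX : X ∈ grading D i)
      (hY : Y ∈ grading D j) : φ X Y = 0 := by
    have := hW i j X hX Y hY
    rwa [grading_eq_bot hij] at this
  have hhh a b : φ (cur (Ess.h K) a) (cur (Ess.h K) b) = 0 :=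
    hbot (by norm_num) (cur_h_mem_grading a) (cur_h_mem_grading b)
  have hhd a : φ (cur (Ess.h K) a) (line D 1) = 0 :=
    hbot (by norm_num) (cur_h_mem_grading a) (line_mem_grading 1)
  have hef a b : φ (cur (Ess.e K) a) (cur (Ess.f K) b) = 0 :=
    hbot (by norm_num) (cur_e_mem_grading a) (cur_f_mem_grading b)
  have hhf a b : φ (cur (Ess.h K) a) (cur (Ess.f K) b) = 0 :=
    hbot (by norm_num) (cur_h_mem_grading a) (cur_f_mem_grading b)
  have hfd a : φ (cur (Ess.f K) a) (line D 1) = 0 :=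
    hbot (by norm_num) (cur_f_mem_grading a) (line_mem_grading 1)
  have hff a b : φ (cur (Ess.f K) a) (cur (Ess.f K) b) = 0 :=
    hbot (by norm_num) (cur_f_mem_grading a) (cur_f_mem_grading b)
  have hhe a b : φ (cur (Ess.h K) a) (cur (Ess.e K) b) = cur (Ess.f K) (γ b a) := by
    rw [hs, heh]
  have hfe a b : φ (cur (Ess.f K) a) (cur (Ess.e K) b) = 0 := by rw [hs, hef]
  have hde a : φ (line D 1) (cur (Ess.e K) a) = cur (Ess.f K) (δ a) := by rw [hs, hed]
  have heee a b c := hJ (cur (Ess.e K) a) (cur (Ess.e K) b) (cur (Ess.e K) c)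
  have heeh a b c := hJ (cur (Ess.e K) a) (cur (Ess.e K) b) (cur (Ess.h K) c)
  have heef a b c := hJ (cur (Ess.e K) a) (cur (Ess.e K) b) (cur (Ess.f K) c)
  have heed a b := hJ (cur (Ess.e K) a) (cur (Ess.e K) b) (line D 1)
  have hehh a b c := hJ (cur (Ess.e K) a) (cur (Ess.h K) b) (cur (Ess.h K) c)
  have hehd a b := hJ (cur (Ess.e K) a) (cur (Ess.h K) b) (line D 1)
  simp only [lie_cur_cur, lie_self, Ess.lie_e_h, Ess.lie_h_e, Ess.lie_f_h, Ess.lie_h_f, Ess.lie_e_f,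
    Ess.lie_f_e, cur_zero_left, lie_line_cur, lie_cur_line, lie_line_line, add_lie, hee, heh, hed,
    hhe, hde, hhh, hhd, hef, hfe, one_smul, map_zero, LinearMap.zero_apply, zero_add, add_zero,
    zero_lie] at heee heeh heef heed hehh hehd
  have heeh_D a b c := congrArg (dcoef D) (heeh a b c)
  replace heee a b c := congrArg (crd D 0) (heee a b c)
  replace heef a b c := congrArg (crd D 2) (heef a b c)
  replace heed a b := congrArg (dcoef D) (heed a b)
  replace hehh a b c := congrArg (crd D 2) (hehh a b c)
  replace hehd a b := congrArg (crd D 2) (hehd a b)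
  simp only [map_add, crd_cur, dcoef_cur, dcoef_line, Ess.e_zero, Ess.f_two,
    one_smul, map_zero, add_zero, zero_add] at heee heeh_D heef heed hehh hehd
  have hα a : α a a = 0 := by
    simpa only [map_add, crd_cur, crd_line, Ess.h_one, one_smul, map_zero, add_zero] using
      congrArg (crd D 1) ((hee a a).symm.trans (halt _))
  have hβ a : β a a = 0 := by
    simpa only [map_add, dcoef_cur, dcoef_line, map_zero, zero_add] using
      congrArg (dcoef D) ((hee a a).symm.trans (halt _))
  obtain ⟨v, hv, w, ξ, s, hαs, hβξ, hγ, hδ⟩ :=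
    exists_parameters_of_weight_two hα hβ heee heeh_D heef heed hehh hehd
  refine ⟨v, hv, w, ξ, d₁₂ K (Ext D) (Ext D) (cur (Ess.f K) ∘ₗ s ∘ₗ crd D 0), ⟨_, rfl⟩, ?_⟩
  rw [eq_sub_iff_add_eq, eq_comm]
  refine eq_of_alternating halt
    (d₁₂ K (Ext D) (Ext D) (cur (Ess.f K) ∘ₗ s ∘ₗ crd D 0) +
      (cochainI D v + cochainII D w + cochainIII D ξ)).2 ?_ ?_ ?_ ?_ ?_ ?_ ?_ ?_ ?_
  all_goals
    intros
    simp only [Submodule.subtype_apply, LinearMap.add_apply, d₁₂_apply_eq,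
      cochainI_apply, cochainII_apply, cochainIII_apply, LinearMap.comp_apply, lie_cur_cur,
      lie_self, Ess.lie_e_h, Ess.lie_f_h, Ess.lie_h_f, Ess.lie_e_f,
      Ess.lie_f_e, cur_zero_left, lie_cur_line, hee, heh, hed, hhh, hhd, hef, hhf,
      hfd, hff, hαs, hβξ, hγ, hδ, crd_cur, crd_line, dcoef_cur, dcoef_line, one_smul, zero_smul,
      Ess.e_zero, Ess.e_one, Ess.h_zero, Ess.h_one, Ess.f_zero, Ess.f_one, map_zero, smul_zero,
      mul_zero, zero_mul, zero_lie, lie_zero, add_zero, zero_add, map_add]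
  · abel
  · abel

end WeightTwo

/-! ### Vanishing in the other positive weights -/

section OtherWeights

variable {K A : Type*} [Field K] [CommRing A] [Algebra K A] [CharP K 2] {D : Derivation K A A}

/-- The general solution of the cocycle equations in weight `1`, where the components of the cocycle
are `(e ⊗ a) ∧ (e ⊗ b) ↦ e ⊗ α(a, b)`, `(e ⊗ a) ∧ (h ⊗ b) ↦ h ⊗ β(a, b) + p(a, b)D`,
`(e ⊗ a) ∧ D ↦ h ⊗ γ(a) + q(a)D`, `(h ⊗ a) ∧ (h ⊗ b) ↦ f ⊗ δ(a, b)`, `(h ⊗ a) ∧ D ↦ f ⊗ ε(a)` and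
`(e ⊗ a) ∧ (f ⊗ b) ↦ f ⊗ ζ(a, b)`. The right-hand sides of the conclusion are the components of the
coboundary of `e ⊗ a ↦ h ⊗ s(a) + t(a)D`, `h ⊗ a ↦ f ⊗ u(a)`, `D ↦ f ⊗ x`. -/
theorem exists_parameters_of_weight_one {α β δ ζ : A →ₗ[K] A →ₗ[K] A} {p : A →ₗ[K] A →ₗ[K] K}
    {γ ε : A →ₗ[K] A} {q : A →ₗ[K] K}
    (heef : ∀ a b c, β a (b * c) + β b (c * a) + α a b * c + ζ b c * a + ζ a c * b = 0)
    (hehh : ∀ a b c, β (a * b) c + β (c * a) b + p a b • D c + δ b c * a + p a c • D b = 0)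
    (hehh' : ∀ a b c, p (a * b) c + p (c * a) b = 0)
    (hehd : ∀ a b, γ (a * b) + β a (D b) + β (D a) b + D (β a b) + ε b * a + q a • D b = 0)
    (hehd' : ∀ a b, q (a * b) + p a (D b) + p (D a) b = 0)
    (hehf : ∀ a b c, ζ (a * b) c + ζ a (b * c) + δ (c * a) b + β a b * c + p a b • D c +
      ζ a c * b = 0)
    (hhhh : ∀ a b c, δ a b * c + δ b c * a + δ c a * b = 0) (hδ : ∀ a b, δ a b = δ b a) :
    ∃ (s u : A →ₗ[K] A) (t : A →ₗ[K] K) (x : A),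
      (∀ a b, α a b = s a * b + a * s b + t a • D b + t b • D a) ∧
      (∀ a b, β a b = s (a * b) + t a • D b + a * u b) ∧ (∀ a b, p a b = t (a * b)) ∧
      (∀ a, γ a = D (s a) + s (D a) + a * x) ∧ (∀ a, q a = t (D a)) ∧
      (∀ a b, δ a b = u a * b + a * u b) ∧ (∀ a, ε a = D (u a) + u (D a) + a * x) ∧
      (∀ a b, ζ a b = s a * b + t a • D b + u (a * b)) := by
  have h2 := two_eq_zero_of_algebra K A
  obtain ⟨s, hs⟩ : ∃ s : A →ₗ[K] A, ∀ a, s a = β a 1 := ⟨β.flip 1, fun a => rfl⟩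
  obtain ⟨t, ht⟩ : ∃ t : A →ₗ[K] K, ∀ a, t a = p a 1 := ⟨p.flip 1, fun a => rfl⟩
  obtain ⟨u, hu⟩ : ∃ u : A →ₗ[K] A, ∀ a, u a = δ a 1 := ⟨δ.flip 1, fun a => rfl⟩
  have hp a b : p a b = t (a * b) := by
    have := eq_of_add_eq_zero_of_charTwo K (hehh' a b 1)
    rw [one_mul] at this
    rw [← this, ht]
  have hq a : q a = t (D a) := by
    have := eq_of_add_eq_zero_of_charTwo K (hehd' a 1)
    rwa [D.map_one_eq_zero, map_zero, add_zero, mul_one, ← ht] at this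
  have hδu a b : δ a b = u a * b + a * u b := by
    have := hhhh a b 1
    rw [hδ 1, ← hu, ← hu] at this
    grind
  have hβ a b : β a b = s (a * b) + t a • D b + a * u b := by
    have := hehh a b 1
    rw [D.map_one_eq_zero, smul_zero, one_mul, ← hs, ← ht, ← hu] at this
    grind
  have hγ a : γ a = D (s a) + s (D a) + a * ε 1 := by
    have := hehd a 1
    rw [D.map_one_eq_zero, smul_zero, mul_one, map_zero, ← hs, ← hs] at this
    grind
  have hε a : ε a = D (u a) + u (D a) + a * ε 1 := by
    have := hehd 1 a
    rw [D.map_one_eq_zero, map_zero, LinearMap.zero_apply, hq, D.map_one_eq_zero, map_zero,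
      zero_smul, hβ, hβ, hγ] at this
    simp only [one_mul, map_add, Derivation.map_smul] at this
    grind
  have hζ a b : ζ a b = s a * b + t a • D b + u (a * b) := by
    have := hehf a 1 b
    rw [← hu, ← hs, ← ht, one_mul, mul_one, mul_one, mul_comm b] at this
    grind
  refine ⟨s, u, t, ε 1, fun a b => ?_, hβ, hp, hγ, hq, hδu, hε, hζ⟩
  have := heef a b 1
  rw [hβ, hβ, hζ, hζ, D.map_one_eq_zero] at this
  simp only [one_mul, mul_one, smul_zero, mul_comm b a] at this
  grind

theorem mem_B2_of_mem_Z2Wt_one {φ : Ext D →ₗ[K] Ext D →ₗ[K] Ext D}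
    (hφ : φ ∈ Z2Wt (grading D) (grading D) 1) : φ ∈ B2 K (Ext D) (Ext D) := by
  obtain ⟨hZ, hW⟩ := hφ
  obtain ⟨halt, hJ⟩ := mem_Z2_iff.1 hZ
  have hs := apply_comm_of_alternating halt
  obtain ⟨α, hee⟩ : ∃ α : A →ₗ[K] A →ₗ[K] A,
      ∀ a b, φ (cur (Ess.e K) a) (cur (Ess.e K) b) = cur (Ess.e K) (α a b) :=
    ⟨(φ.compl₁₂ (cur (Ess.e K)) (cur (Ess.e K))).compr₂ (crd D 0), fun a b =>
      eq_cur_e_of_mem (hW (-1) (-1) _ (cur_e_mem_grading a) _ (cur_e_mem_grading b))⟩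
  obtain ⟨β, p, heh⟩ : ∃ (β : A →ₗ[K] A →ₗ[K] A) (p : A →ₗ[K] A →ₗ[K] K),
      ∀ a b, φ (cur (Ess.e K) a) (cur (Ess.h K) b) = cur (Ess.h K) (β a b) + line D (p a b) :=
    ⟨(φ.compl₁₂ (cur (Ess.e K)) (cur (Ess.h K))).compr₂ (crd D 1),
      (φ.compl₁₂ (cur (Ess.e K)) (cur (Ess.h K))).compr₂ (dcoef D), fun a b =>
      eq_cur_h_add_line_of_mem (hW (-1) 0 _ (cur_e_mem_grading a) _ (cur_h_mem_grading b))⟩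
  obtain ⟨γ, q, hed⟩ : ∃ (γ : A →ₗ[K] A) (q : A →ₗ[K] K),
      ∀ a, φ (cur (Ess.e K) a) (line D 1) = cur (Ess.h K) (γ a) + line D (q a) :=
    ⟨crd D 1 ∘ₗ φ.flip (line D 1) ∘ₗ cur (Ess.e K),
      dcoef D ∘ₗ φ.flip (line D 1) ∘ₗ cur (Ess.e K), fun a =>
      eq_cur_h_add_line_of_mem (hW (-1) 0 _ (cur_e_mem_grading a) _ (line_mem_grading 1))⟩
  obtain ⟨δ, hhh⟩ : ∃ δ : A →ₗ[K] A →ₗ[K] A,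
      ∀ a b, φ (cur (Ess.h K) a) (cur (Ess.h K) b) = cur (Ess.f K) (δ a b) :=
    ⟨(φ.compl₁₂ (cur (Ess.h K)) (cur (Ess.h K))).compr₂ (crd D 2), fun a b =>
      eq_cur_f_of_mem (hW 0 0 _ (cur_h_mem_grading a) _ (cur_h_mem_grading b))⟩
  obtain ⟨ε, hhd⟩ : ∃ ε : A →ₗ[K] A,
      ∀ a, φ (cur (Ess.h K) a) (line D 1) = cur (Ess.f K) (ε a) :=
    ⟨crd D 2 ∘ₗ φ.flip (line D 1) ∘ₗ cur (Ess.h K), fun a =>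
      eq_cur_f_of_mem (hW 0 0 _ (cur_h_mem_grading a) _ (line_mem_grading 1))⟩
  obtain ⟨ζ, hef⟩ : ∃ ζ : A →ₗ[K] A →ₗ[K] A,
      ∀ a b, φ (cur (Ess.e K) a) (cur (Ess.f K) b) = cur (Ess.f K) (ζ a b) :=
    ⟨(φ.compl₁₂ (cur (Ess.e K)) (cur (Ess.f K))).compr₂ (crd D 2), fun a b =>
      eq_cur_f_of_mem (hW (-1) 1 _ (cur_e_mem_grading a) _ (cur_f_mem_grading b))⟩
  have hbot {i j : ℤ} (hij : 1 < |i + j + 1|) {X Y : Ext D} (hX : X ∈ grading D i)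
      (hY : Y ∈ grading D j) : φ X Y = 0 := by
    have := hW i j X hX Y hY
    rwa [grading_eq_bot hij] at this
  have hhf a b : φ (cur (Ess.h K) a) (cur (Ess.f K) b) = 0 :=
    hbot (by norm_num) (cur_h_mem_grading a) (cur_f_mem_grading b)
  have hfd a : φ (cur (Ess.f K) a) (line D 1) = 0 :=
    hbot (by norm_num) (cur_f_mem_grading a) (line_mem_grading 1)
  have hff a b : φ (cur (Ess.f K) a) (cur (Ess.f K) b) = 0 :=
    hbot (by norm_num) (cur_f_mem_grading a) (cur_f_mem_grading b)
  have hhe a b : φ (cur (Ess.h K) a) (cur (Ess.e K) b) =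
    cur (Ess.h K) (β b a) + line D (p b a) := by rw [hs, heh]
  have hfe a b : φ (cur (Ess.f K) a) (cur (Ess.e K) b) = cur (Ess.f K) (ζ b a) := by rw [hs, hef]
  have hde a : φ (line D 1) (cur (Ess.e K) a) = cur (Ess.h K) (γ a) + line D (q a) := by
    rw [hs, hed]
  have heef a b c := hJ (cur (Ess.e K) a) (cur (Ess.e K) b) (cur (Ess.f K) c)
  have hehh a b c := hJ (cur (Ess.e K) a) (cur (Ess.h K) b) (cur (Ess.h K) c)
  have hehd a b := hJ (cur (Ess.e K) a) (cur (Ess.h K) b) (line D 1)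
  have hehf a b c := hJ (cur (Ess.e K) a) (cur (Ess.h K) b) (cur (Ess.f K) c)
  have hhhh a b c := hJ (cur (Ess.h K) a) (cur (Ess.h K) b) (cur (Ess.h K) c)
  simp only [lie_cur_cur, lie_self, Ess.lie_e_h, Ess.lie_h_e, Ess.lie_f_h, Ess.lie_h_f, Ess.lie_e_f,
    Ess.lie_f_e, cur_zero_left, lie_line_cur, lie_cur_line, lie_line_line, add_lie, hee, heh, hed,
    hhe, hde, hhh, hhd, hef, hfe, hhf, one_smul, map_zero, LinearMap.zero_apply, zero_add,
    add_zero, zero_lie] at heef hehh hehd hehf hhhh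
  have hehh' a b c := congrArg (dcoef D) (hehh a b c)
  have hehd' a b := congrArg (dcoef D) (hehd a b)
  replace heef a b c := congrArg (crd D 1) (heef a b c)
  replace hehh a b c := congrArg (crd D 1) (hehh a b c)
  replace hehd a b := congrArg (crd D 1) (hehd a b)
  replace hehf a b c := congrArg (crd D 2) (hehf a b c)
  replace hhhh a b c := congrArg (crd D 2) (hhhh a b c)
  simp only [map_add, crd_cur, crd_line, dcoef_cur, dcoef_line, Ess.h_one, Ess.f_two, one_smul,
    map_zero, add_zero, zero_add, ← add_assoc] at heef hehh hehh' hehd hehd' hehf hhhh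
  have hδ a b : δ a b = δ b a := by
    have := congrArg (crd D 2) (hs (cur (Ess.h K) a) (cur (Ess.h K) b))
    simpa only [hhh, crd_cur, Ess.f_two, one_smul] using this
  obtain ⟨s, u, t, x, hα, hβ, hp, hγ, hq, hδu, hε, hζ⟩ :=
    exists_parameters_of_weight_one heef hehh hehh' hehd hehd' hehf hhhh hδ
  let ψ : Ext D →ₗ[K] Ext D := cur (Ess.h K) ∘ₗ s ∘ₗ crd D 0 + line D ∘ₗ t ∘ₗ crd D 0 +
    cur (Ess.f K) ∘ₗ u ∘ₗ crd D 1 + (dcoef D).smulRight (cur (Ess.f K) x)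
  refine ⟨d₁₂ K (Ext D) (Ext D) ψ, ⟨_, rfl⟩, ?_⟩
  refine eq_of_alternating (d₁₂ K (Ext D) (Ext D) ψ).2 halt ?_ ?_ ?_ ?_ ?_ ?_ ?_ ?_ ?_
  all_goals
    intros
    simp only [ψ, Submodule.subtype_apply, LinearMap.add_apply, d₁₂_apply_eq, LinearMap.comp_apply,
      LinearMap.smulRight_apply, lie_cur_cur, lie_line_line,
      lie_self, Ess.lie_e_h, Ess.lie_h_e, Ess.lie_f_h, Ess.lie_h_f, Ess.lie_e_f,
      cur_zero_left, lie_line_cur, lie_cur_line, hee, heh, hed, hhh, hhd, hef, hhf,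
      hfd, hff, hα, hβ, hp, hγ, hq, hδu, hε, hζ, crd_cur, crd_line, dcoef_cur, dcoef_line, one_smul,
      zero_smul, Ess.e_zero, Ess.e_one, Ess.h_zero, Ess.h_one, Ess.f_zero, Ess.f_one, map_zero,
      zero_lie, lie_zero, add_zero, zero_add, map_add]
  all_goals abel

/-- In weights above `2` only `(e ⊗ A) ∧ (e ⊗ A)` can have a nonzero image, and only for `l = 3`;
there the cocycle equation on `e ⊗ a`, `e ⊗ b`, `h ⊗ 1` rules it out. -/
theorem eq_zero_of_mem_Z2Wt {l : ℤ} (hl : 3 ≤ l) {φ : Ext D →ₗ[K] Ext D →ₗ[K] Ext D}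
    (hφ : φ ∈ Z2Wt (grading D) (grading D) l) : φ = 0 := by
  obtain ⟨hZ, hW⟩ := hφ
  obtain ⟨halt, hJ⟩ := mem_Z2_iff.1 hZ
  have hs := apply_comm_of_alternating halt
  have hbot {i j : ℤ} (hij : 1 < i + j + l) {X Y : Ext D} (hX : X ∈ grading D i)
      (hY : Y ∈ grading D j) : φ X Y = 0 := by
    have := hW i j X hX Y hY
    rwa [grading_eq_bot (hij.trans_le (le_abs_self _))] at this
  have heh a b : φ (cur (Ess.e K) a) (cur (Ess.h K) b) = 0 :=
    hbot (by linarith) (cur_e_mem_grading a) (cur_h_mem_grading b)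
  refine eq_of_alternating halt (fun _ => rfl) (fun a b => ?_) heh
    (fun a => hbot (by linarith) (cur_e_mem_grading a) (line_mem_grading 1))
    (fun a b => hbot (by linarith) (cur_h_mem_grading a) (cur_h_mem_grading b))
    (fun a => hbot (by linarith) (cur_h_mem_grading a) (line_mem_grading 1))
    (fun a b => hbot (by linarith) (cur_e_mem_grading a) (cur_f_mem_grading b))
    (fun a b => hbot (by linarith) (cur_h_mem_grading a) (cur_f_mem_grading b))
    (fun a => hbot (by linarith) (cur_f_mem_grading a) (line_mem_grading 1))
    (fun a b => hbot (by linarith) (cur_f_mem_grading a) (cur_f_mem_grading b))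
  rw [LinearMap.zero_apply, LinearMap.zero_apply]
  obtain rfl | hl := hl.eq_or_lt
  · have hee := eq_cur_f_of_mem (hW (-1) (-1) _ (cur_e_mem_grading a) _ (cur_e_mem_grading b))
    have := hJ (cur (Ess.e K) a) (cur (Ess.e K) b) (cur (Ess.h K) 1)
    rw [lie_cur_cur, lie_cur_cur, lie_cur_cur, lie_self, cur_zero_left, Ess.lie_e_h, Ess.lie_h_e,
      one_mul, mul_one, heh, hs (cur (Ess.h K) 1), heh, hs (cur (Ess.e K) b), map_zero,
      LinearMap.zero_apply, zero_lie, zero_lie, zero_add, add_zero, add_zero,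
      add_self_eq_zero (K := K), zero_add, hee, lie_cur_cur, Ess.lie_f_h, mul_one] at this
    rw [hee, this]
  · exact hbot (by linarith) (cur_e_mem_grading a) (cur_e_mem_grading b)

end OtherWeights

/-! ### Relations between the classes of the three families -/

section Relations

variable {K A : Type*} [Field K] [CommRing A] [Algebra K A] [CharP K 2] {D : Derivation K A A}

/-- The cocycle attached to `w = D(u)` is the coboundary of `e ⊗ a ↦ f ⊗ au`. -/
theorem cochainII_mem_B2 (u : A) : (cochainII D (D u)).1 ∈ B2 K (Ext D) (Ext D) := by
  have h2 := two_eq_zero_of_algebra K A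
  refine mem_B2_iff.2 ⟨cur (Ess.f K) ∘ₗ LinearMap.mulRight K u ∘ₗ crd D 0, fun X Y => ?_⟩
  apply ext_coordinates
  all_goals
    simp only [cochainII_apply, LinearMap.comp_apply, LinearMap.mulRight_apply, map_add,
      crd_zero_lie, crd_one_lie, crd_two_lie, dcoef_lie, crd_cur, dcoef_cur, Ess.f_zero, Ess.f_one,
      Ess.f_two, zero_smul, one_smul, map_zero, Derivation.leibniz, smul_eq_mul,
      add_zero]
  all_goals simp only [Algebra.smul_def]
  all_goals grind

/-- The cochain `ψ` with the given coboundary is not assumed homogeneous: only its component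
`e ⊗ a ↦ f ⊗ r(a)` is seen by the equations used here, and the preimage of `w` is `r(1)`. -/
theorem parameters_eq_zero_of_mem_B2 {v w : A} {ξ : Xi D (⊥ : Submodule K A)}
    (h : (cochainI D v).1 + (cochainII D w).1 + (cochainIII D ξ).1 ∈ B2 K (Ext D) (Ext D)) :
    v = 0 ∧ w ∈ image D ∧ ξ = 0 := by
  obtain ⟨ψ, hψ⟩ := mem_B2_iff.1 h
  have hee a := congrArg (dcoef D) (hψ (cur (Ess.e K) a) (cur (Ess.e K) 1))
  have heh a b := congrArg (crd D 2) (hψ (cur (Ess.e K) a) (cur (Ess.h K) b))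
  have hed a := congrArg (crd D 2) (hψ (cur (Ess.e K) a) (line D 1))
  simp only [LinearMap.add_apply, cochainI_apply, cochainII_apply, cochainIII_apply, lie_cur_cur,
    lie_cur_line, lie_self, Ess.lie_e_h, cur_zero_left, map_add, map_zero, crd_cur, crd_line,
    dcoef_cur, dcoef_line, dcoef_lie, crd_two_lie, Ess.e_zero, Ess.e_one, Ess.e_two, Ess.h_zero,
    Ess.h_one, Ess.h_two, Ess.f_two, one_smul, zero_smul, smul_zero, mul_zero, zero_mul, add_zero,
    zero_add, mul_one] at hee heh hed
  have hξ : ξ = 0 := Subtype.ext (LinearMap.ext hee)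
  subst hξ
  have hv : v = 0 := by
    have : 1 * 1 * v = crd D 2 (ψ (cur (Ess.e K) 1)) * 1 +
        crd D 2 (ψ (cur (Ess.e K) (1 * 1))) := by simpa using heh 1 1
    rwa [one_mul, one_mul, mul_one, add_self_eq_zero (K := K)] at this
  refine ⟨hv, ⟨crd D 2 (ψ (cur (Ess.e K) 1)), ?_⟩, rfl⟩
  have := hed 1
  rw [D.map_one_eq_zero, map_zero, map_zero, map_zero] at this
  simpa using this.symm

end Relations

/-! ### The isomorphism -/

section Assembly

variable {K A : Type*} [Field K] [CommRing A] [Algebra K A] [CharP K 2] (D : Derivation K A A)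

/-- The map `v ↦ cochainI D v` as a linear map into the bilinear maps. -/
def cochainILinear : A →ₗ[K] (Ext D →ₗ[K] Ext D →ₗ[K] Ext D) where
  toFun v := (cochainI D v).1
  map_add' v v' := by
    refine LinearMap.ext fun X => LinearMap.ext fun Y => ?_
    simp only [LinearMap.add_apply, cochainI_apply, ← map_add]
    congr 1
    ring
  map_smul' c v := by
    refine LinearMap.ext fun X => LinearMap.ext fun Y => ?_
    change _ = c • cur (Ess.f K) _
    rw [cochainI_apply, ← map_smul, smul_add, mul_smul_comm, mul_smul_comm]

/-- The map `w ↦ cochainII D w` as a linear map into the bilinear maps. -/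
def cochainIILinear : A →ₗ[K] (Ext D →ₗ[K] Ext D →ₗ[K] Ext D) where
  toFun w := (cochainII D w).1
  map_add' w w' := by
    refine LinearMap.ext fun X => LinearMap.ext fun Y => ?_
    simp only [LinearMap.add_apply, cochainII_apply, ← map_add]
    congr 1
    simp only [mul_add, smul_add]
    abel
  map_smul' c w := by
    refine LinearMap.ext fun X => LinearMap.ext fun Y => ?_
    change _ = c • cur (Ess.f K) _
    rw [cochainII_apply, ← map_smul, smul_add, mul_smul_comm, mul_smul_comm, smul_comm c,
      smul_comm c]

/-- The map `ξ ↦ cochainIII D ξ` as a linear map into the bilinear maps. -/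
def cochainIIILinear : Xi D (⊥ : Submodule K A) →ₗ[K] (Ext D →ₗ[K] Ext D →ₗ[K] Ext D) where
  toFun ξ := (cochainIII D ξ).1
  map_add' ξ ξ' := by
    refine LinearMap.ext fun X => LinearMap.ext fun Y => ?_
    simp only [LinearMap.add_apply, cochainIII_apply, Submodule.coe_add, add_smul, map_add]
    abel
  map_smul' c ξ := by
    refine LinearMap.ext fun X => LinearMap.ext fun Y => ?_
    simp only [LinearMap.smul_apply, RingHom.id_apply, cochainIII_apply, Submodule.coe_smul,
      smul_assoc, map_smul, smul_add, map_add]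

/-- The map sending `(v, w + D(A), ξ)` to the sum of the classes of the three associated cochains,
with values in bilinear maps modulo coboundaries. -/
def classMap : (invariants D × (A ⧸ image D) × Xi D (⊥ : Submodule K A)) →ₗ[K]
    ((Ext D →ₗ[K] Ext D →ₗ[K] Ext D) ⧸ B2 K (Ext D) (Ext D)) :=
  ((B2 K (Ext D) (Ext D)).mkQ ∘ₗ cochainILinear D ∘ₗ (invariants D).subtype).coprod
    (((image D).liftQ ((B2 K (Ext D) (Ext D)).mkQ ∘ₗ cochainIILinear D) (by
        rintro _ ⟨u, rfl⟩
        exact (Submodule.Quotient.mk_eq_zero _).2 (cochainII_mem_B2 u))).coprod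
      ((B2 K (Ext D) (Ext D)).mkQ ∘ₗ cochainIIILinear D))

theorem classMap_apply (v : invariants D) (w : A) (ξ : Xi D (⊥ : Submodule K A)) :
    classMap D (v, Submodule.Quotient.mk w, ξ) = (B2 K (Ext D) (Ext D)).mkQ
      ((cochainI D v.1).1 + (cochainII D w).1 + (cochainIII D ξ).1) := by
  rw [add_assoc, map_add, map_add]
  rfl

theorem classMap_injective : Function.Injective (classMap D) := by
  refine (injective_iff_map_eq_zero _).2 ?_
  rintro ⟨v, w, ξ⟩ h
  obtain ⟨w, rfl⟩ := Submodule.Quotient.mk_surjective _ w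
  rw [classMap_apply] at h
  obtain ⟨hv, hw, rfl⟩ := parameters_eq_zero_of_mem_B2 ((Submodule.Quotient.mk_eq_zero _).1 h)
  rw [(Submodule.Quotient.mk_eq_zero _).2 hw, show v = 0 from Subtype.ext hv]
  rfl

theorem range_classMap :
    LinearMap.range (classMap D) = H2Wt (grading D) (grading D) 2 := by
  apply le_antisymm
  · rintro _ ⟨⟨v, w, ξ⟩, rfl⟩
    obtain ⟨w, rfl⟩ := Submodule.Quotient.mk_surjective _ w
    rw [classMap_apply]
    exact Submodule.mem_map_of_mem (add_mem (add_mem (cochainI_mem_Z2Wt v.2) (cochainII_mem_Z2Wt w))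
      (cochainIII_mem_Z2Wt ξ))
  · rintro _ ⟨φ, hφ, rfl⟩
    obtain ⟨v, hv, w, ξ, h⟩ := sub_mem_B2_of_mem_Z2Wt_two hφ
    refine ⟨(⟨v, hv⟩, Submodule.Quotient.mk w, ξ), ?_⟩
    rw [classMap_apply]
    exact ((Submodule.Quotient.eq _).2 h).symm

theorem H2Wt_eq_bot {l : ℤ} (hl : 0 < l) (hl2 : l ≠ 2) :
    H2Wt (grading D) (grading D) l = ⊥ := by
  rw [eq_bot_iff]
  rintro _ ⟨φ, hφ, rfl⟩
  refine (Submodule.Quotient.mk_eq_zero _).2 ?_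
  obtain rfl | hl3 : l = 1 ∨ 3 ≤ l := by omega
  · exact mem_B2_of_mem_Z2Wt_one hφ
  · rw [eq_zero_of_mem_Z2Wt hl3 hφ]
    exact zero_mem _

/-- Weight `2` is the only nonzero summand of the positive cohomology. -/
theorem lof_two_bijective : Function.Bijective (DirectSum.lof K {l : ℤ // 0 < l}
    (fun l => H2Wt (grading D) (grading D) l.1) ⟨2, two_pos⟩) := by
  refine ⟨DirectSum.of_injective _, fun x => ?_⟩
  induction x using DirectSum.induction_on with
  | zero => exact ⟨0, map_zero _⟩
  | of l x =>
    obtain ⟨l, hl⟩ := l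
    by_cases hl2 : l = 2
    · subst hl2
      exact ⟨x, rfl⟩
    · have hx : x = 0 :=
        Subtype.ext ((H2Wt_eq_bot D hl hl2).le x.2)
      exact ⟨0, by rw [hx, map_zero, map_zero]⟩
  | add x y hx hy =>
    obtain ⟨x, rfl⟩ := hx
    obtain ⟨y, rfl⟩ := hy
    exact ⟨x + y, map_add _ _ _⟩

/-- The isomorphism of `A^D ⊕ A/D(A) ⊕ Ξ_{D,0}` with the positive second cohomology, induced by
`classMap`. -/
def equivH2Pos : (invariants D × (A ⧸ image D) × Xi D (⊥ : Submodule K A)) ≃ₗ[K]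
    H2Pos (grading D) (grading D) :=
  (LinearEquiv.ofInjective (classMap D) (classMap_injective D)).trans
    ((LinearEquiv.ofEq _ _ (range_classMap D)).trans
      (LinearEquiv.ofBijective _ (lof_two_bijective D)))

theorem equivH2Pos_apply (x : invariants D × (A ⧸ image D) × Xi D (⊥ : Submodule K A))
    (φ : Ext D →ₗ[K] Ext D →ₗ[K] Ext D) (hφ : φ ∈ Z2Wt (grading D) (grading D) 2)
    (h : classMap D x = (B2 K (Ext D) (Ext D)).mkQ φ) :
    equivH2Pos D x = posClass 2 two_pos φ hφ :=
  congrArg (DirectSum.lof K {l : ℤ // 0 < l} (fun l => H2Wt (grading D) (grading D) l.1)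
    ⟨2, two_pos⟩) (Subtype.ext h)

end Assembly

end CurrentLie

theorem mainTheorem5 {K A : Type*} [Field K] [CharP K 2] [CommRing A] [Algebra K A]
    (D : Derivation K A A) (hD : D ≠ 0) :
    ∃ (hI : ∀ v ∈ CurrentLie.invariants D, (CurrentLie.cochainI D v).1 ∈
          CurrentLie.Z2Wt (CurrentLie.grading D) (CurrentLie.grading D) 2)
      (hII : ∀ w : A, (CurrentLie.cochainII D w).1 ∈
          CurrentLie.Z2Wt (CurrentLie.grading D) (CurrentLie.grading D) 2)
      (hIII : ∀ ξ : CurrentLie.Xi D (⊥ : Submodule K A), (CurrentLie.cochainIII D ξ).1 ∈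
          CurrentLie.Z2Wt (CurrentLie.grading D) (CurrentLie.grading D) 2)
      (F : (CurrentLie.invariants D × (A ⧸ CurrentLie.image D) ×
            CurrentLie.Xi D (⊥ : Submodule K A)) ≃ₗ[K]
          CurrentLie.H2Pos (CurrentLie.grading D) (CurrentLie.grading D)),
      (∀ v : CurrentLie.invariants D, F (v, 0, 0) =
        CurrentLie.posClass 2 two_pos (CurrentLie.cochainI D v.1).1 (hI v.1 v.2)) ∧
      (∀ w : A, F (0, Submodule.Quotient.mk w, 0) =
        CurrentLie.posClass 2 two_pos (CurrentLie.cochainII D w).1 (hII w)) ∧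
      (∀ ξ : CurrentLie.Xi D (⊥ : Submodule K A), F (0, 0, ξ) =
        CurrentLie.posClass 2 two_pos (CurrentLie.cochainIII D ξ).1 (hIII ξ)) := by
  refine ⟨fun v hv => CurrentLie.cochainI_mem_Z2Wt hv, CurrentLie.cochainII_mem_Z2Wt,
    CurrentLie.cochainIII_mem_Z2Wt, CurrentLie.equivH2Pos D, fun v => ?_, fun w => ?_, fun ξ => ?_⟩
  · refine CurrentLie.equivH2Pos_apply D _ _ _ ?_
    simp only [CurrentLie.classMap, LinearMap.coprod_apply, map_zero, add_zero]
    rfl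
  · refine CurrentLie.equivH2Pos_apply D _ _ _ ?_
    simp only [CurrentLie.classMap, LinearMap.coprod_apply, map_zero, add_zero, zero_add]
    rfl
  · refine CurrentLie.equivH2Pos_apply D _ _ _ ?_
    simp only [CurrentLie.classMap, LinearMap.coprod_apply, map_zero, zero_add]
    rfl

end
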